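/- \textbf{Lemma (Vanishing covariance).} Let $W\subset\mathbb{R}^3$ be a closed ball of volume one. For $t>0$ let $\eta_t$ be a Poisson point process on $W$ with intensity measure $t\lambda_3|_W$ ($\lambda_3$ being Lebesgue measure), regarded as a random set of points, and let $r_t>0$ be connectivity radii in the sparse regime $t r_t^3\to 0$ as $t\to\infty$. Let $e_1,e_2,e_3$ be the standard basis of $\mathbb{R}^3$ and $L=\operatorname{span}\{e_1,e_2\}$. To each $x\in\mathbb{S}^2$ associate a rotation $\theta(x)\in SO(3)$ with $\theta(x)e_3=x$, and put $L_x=\theta(x)L$ (so $L_x$ is the plane through the origin orthogonal to $x$, whatever the choice of $\theta(x)$). Write $[v,w]|_{L_x}$ for the orthogonal projection of the segment $[v,w]$ onto $L_x$, and let $$\xi_{t,x}(L_x)=\tfrac18\,\#\bigl\{(v_1,v_2,w_1,w_2)\in(\eta_t)^4_{\neq}:\ \|v_1-v_2\|\le r_t,\ \|w_1-w_2\|\le r_t,\ [v_1,v_2]|_{L_x}\cap[w_1,w_2]|_{L_x}\neq\emptyset\bigr\}$$ be the number of crossings in the projection onto $L_x$ of the random geometric graph on $\eta_t$ with connectivity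 radius $r_t$, where $(\eta_t)^4_{\neq}$ is the set of $4$-tuples of pairwise distinct points of $\eta_t$. Let $\mathbb{S}^2_{++}=\{x\in\mathbb{S}^2: x_1,x_2,x_3>0\}$, let $d_{\mathbb{S}}$ be the spherical (geodesic) distance, and let $\alpha>0$. Then there are quantities $c_{t,\alpha}=c^{(1)}_{t,\alpha}+c^{(2)}_{t,\alpha}$, not depending on $x$, $y$, with $$c^{(1)}_{t,\alpha}=\mathcal{O}\bigl(t^6r_t^{13}\bigr),\qquad c^{(2)}_{t,\alpha}=\mathcal{O}\bigl(t^{4+3\alpha}r_t^{9}\bigr)\qquad (t\to\infty),$$ such that for all $t>0$ and all $x,y\in\mathbb{S}^2_{++}$ with $d_{\mathbb{S}}(x,y)>t^{-\alpha}$, the variables $\xi_{t,x}(L_x)$ and $\xi_{t,y}(L_y)$ have finite second moments and $$\operatorname{Cov}\bigl(\xi_{t,x}(L_x),\xi_{t,y}(L_y)\bigr)<c_{t,\alpha}.$$ -/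

import Mathlib

open MeasureTheory ProbabilityTheory Filter Topology Asymptotics

noncomputable section

/-- Three-dimensional Euclidean space. -/
abbrev E3 : Type := EuclideanSpace ℝ (Fin 3)

/-- The unit sphere `S²` in three-dimensional Euclidean space. -/
abbrev Sphere2 : Type := Metric.sphere (0 : E3) 1

/-- `η` is a Poisson point process with (finite, diffuse) intensity measure `Λ`. Such a process is
simple, so it is given as the random set of its points: the number of points in a Borel set `B` is
Poisson distributed with mean `Λ B`, and the numbers of points in disjoint Borel sets are
independent. -/
structure IsPoissonProcess {Ω : Type*} [MeasurableSpace Ω] (P : Measure Ω)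
    {E : Type*} [MeasurableSpace E] (Λ : Measure E) (η : Ω → Set E) : Prop where
  measurable_count : ∀ B : Set E, MeasurableSet B → Measurable fun ω => (η ω ∩ B).encard
  hasLaw_count : ∀ B : Set E, MeasurableSet B → Λ B ≠ ⊤ →
    HasLaw (fun ω => (η ω ∩ B).encard)
      ((poissonMeasure (Λ B).toNNReal).map (Nat.cast : ℕ → ℕ∞)) P
  indep_count : ∀ (n : ℕ) (B : Fin n → Set E), (∀ i, MeasurableSet (B i)) →
    Pairwise (fun i j => Disjoint (B i) (B j)) →
    iIndepFun (fun i ω => (η ω ∩ B i).encard) P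

/-- The open positive octant `S²₊₊` of the sphere. -/
def spherePos : Set Sphere2 := {x | ∀ i, 0 < (x : E3) i}

/-- The spherical (geodesic) distance on `S²`. -/
def dSphere (x y : Sphere2) : ℝ := InnerProductGeometry.angle (x : E3) (y : E3)

/-- The reference plane spanned by the first two standard basis vectors. -/
def refPlane : Submodule ℝ E3 :=
  Submodule.span ℝ {EuclideanSpace.single (0 : Fin 3) (1 : ℝ), EuclideanSpace.single 1 1}

/-- The image of a vector under a rotation. -/
def rotate (R : Matrix.specialOrthogonalGroup (Fin 3) ℝ) : E3 →ₗ[ℝ] E3 :=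
  Matrix.toEuclideanLin (R : Matrix (Fin 3) (Fin 3) ℝ)

/-- The plane `L_x = θ(x) L` associated with `x`. -/
def plane (θ : Sphere2 → Matrix.specialOrthogonalGroup (Fin 3) ℝ) (x : Sphere2) :
    Submodule ℝ E3 :=
  refPlane.map (rotate (θ x))

/-- The orthogonal projection `[v, w]|_L` of the segment `[v, w]` onto `L`. -/
def projSegment (L : Submodule ℝ E3) (v w : E3) : Set E3 :=
  L.starProjection '' segment ℝ v w

/-- The intersection of the projections of the edges `{p 0, p 1}` and `{p 2, p 3}`. -/
def crossing (L : Submodule ℝ E3) (p : Fin 4 → E3) : Set E3 :=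
  projSegment L (p 0) (p 1) ∩ projSegment L (p 2) (p 3)

/-- The 4-tuples of distinct vertices in `V` which form two edges of the geometric graph with
connectivity radius `r` whose projections onto `L` meet. -/
def crossingTuples (V : Set E3) (r : ℝ) (L : Submodule ℝ E3) : Set (Fin 4 → E3) :=
  {p | Function.Injective p ∧ (∀ i, p i ∈ V) ∧ ‖p 0 - p 1‖ ≤ r ∧ ‖p 2 - p 3‖ ≤ r ∧
    (crossing L p).Nonempty}

/-- The number of crossings `ξ(A)` in a set `A ⊆ L`: one eighth of the number of crossing tuples
whose crossing lies in `A`. -/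
def crossingCount (V : Set E3) (r : ℝ) (L : Submodule ℝ E3) (A : Set E3) : ℝ :=
  (1 / 8 : ℝ) * ({p ∈ crossingTuples V r L | crossing L p ⊆ A}.ncard : ℝ)

end

/-! Write 8ξ as the number of 4-tuples of distinct points of η lying in a closed set (`crossSet`),
and expand the product of the counts for x and y as a sum over pairs (p, q) of such tuples. Classify
the pairs by the set K of positions at which q uses a point not in p, and by a map σ locating the
other entries of q in p. Gluing p and q gives a tuple of 4 + |K| distinct points, and the factorial
moment formula (`lintegral_tupleMeasure`) turns the expected number of these into an integral
against a power of the intensity Λ. The pattern in which all of q is new gives exactly the product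
of the means, so only overlapping patterns contribute to the covariance bound
(`lintegral_tupleMeasure_mul_le`).

Two scales control the rest: a ball of radius r has intensity of order b = t r³, and a tube of
radius 2r along a direction, cut by W, has intensity of order τ = t r². The tuples p have measure of
order b²τt = t⁴r⁸. If q has two or three new points, integrating these out gives bτ + b² or b²τ,
hence t⁶r¹³, t⁶r¹⁴ and t⁷r¹⁶; sparseness lets the first dominate.

If q has at most one new point, the shared points meet both edges of p. Then p 2 - p 0 lies in a
tube along x and also in a tube along y (`mem_tubeSet_of_glue`). Directions whose angle has sine at
least δ make this intersection bounded, of intensity D of order t r³/δ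
(`intensity_tube_inter_tube_le`), and the contribution is (1 + b)b²Dt, of order t⁴r⁹/δ. Here δ =
t^(-α)/2. -/

/-- The families of pairwise distinct points of `V` indexed by `ι`. -/
def injTuples (ι : Type*) {E : Type*} (V : Set E) : Set (ι → E) :=
  {p | Function.Injective p ∧ ∀ i, p i ∈ V}

/-- The measurable sets of non-injective families, and the rectangles with pairwise disjoint
sides. -/
def offDiagSystem (ι E : Type*) [MeasurableSpace E] : Set (Set (ι → E)) :=
  {A | MeasurableSet A ∧ ∀ p ∈ A, ¬ Function.Injective p} ∪
  {A | ∃ B : ι → Set E, (∀ i, MeasurableSet (B i)) ∧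
    Pairwise (fun i j => Disjoint (B i) (B j)) ∧ A = Set.univ.pi B}

/-! ### Off-diagonal rectangles and the product σ-algebra -/

section FactorialMeasure

variable {E ι : Type*}

lemma injTuples_finite [Finite ι] {V : Set E} (hV : V.Finite) : (injTuples ι V).Finite :=
  (Set.Finite.pi' fun _ => hV).subset fun _ hp => hp.2

lemma measurableSet_of_mem_offDiagSystem [Countable ι] [MeasurableSpace E] {A : Set (ι → E)}
    (hA : A ∈ offDiagSystem ι E) : MeasurableSet A := by
  rcases hA with hA | ⟨B, hB, -, rfl⟩
  · exact hA.1
  · exact MeasurableSet.univ_pi hB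

lemma isPiSystem_offDiagSystem [Countable ι] [MeasurableSpace E] :
    IsPiSystem (offDiagSystem ι E) := by
  intro A hA A' hA' _
  have hm := (measurableSet_of_mem_offDiagSystem hA).inter (measurableSet_of_mem_offDiagSystem hA')
  rcases hA with hA | ⟨B, hB, hd, rfl⟩
  · exact Or.inl ⟨hm, fun p hp => hA.2 p hp.1⟩
  rcases hA' with hA' | ⟨B', hB', hd', rfl⟩
  · exact Or.inl ⟨hm, fun p hp => hA'.2 p hp.2⟩
  refine Or.inr ⟨fun i => B i ∩ B' i, fun i => (hB i).inter (hB' i), fun i j hij => ?_, ?_⟩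
  · exact (hd hij).mono Set.inter_subset_left Set.inter_subset_left
  · exact Set.pi_inter_distrib.symm

variable [TopologicalSpace E] [SecondCountableTopology E] [T2Space E] [MeasurableSpace E]
  [BorelSpace E]

lemma measurableSet_not_injective [Finite ι] :
    MeasurableSet {p : ι → E | ¬ Function.Injective p} := by
  have : {p : ι → E | ¬ Function.Injective p} =
      ⋃ (i : ι) (j : ι) (_ : i ≠ j), {p | p i = p j} := by
    ext p
    simp [Function.Injective]
    grind
  rw [this]
  exact .iUnion fun i => .iUnion fun j => .iUnion fun _ =>
    (isClosed_eq (continuous_apply i) (continuous_apply j)).measurableSet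

/-- Every open set of families is, off the diagonal, a countable union of rectangles with pairwise
disjoint sides. -/
lemma exists_countable_offDiagSystem_cover [Finite ι] {U : Set (ι → E)} (hU : IsOpen U) :
    ∃ T : Set (Set (ι → E)), T.Countable ∧ T ⊆ offDiagSystem ι E ∧ ⋃₀ T = U := by
  let b := TopologicalSpace.countableBasis E
  have hb : TopologicalSpace.IsTopologicalBasis b := TopologicalSpace.isBasis_countableBasis E
  have : Countable b := (TopologicalSpace.countable_countableBasis E).to_subtype
  let T : Set (Set (ι → E)) := (fun f : ι → b => Set.univ.pi fun i => (f i : Set E)) ''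
    {f | Pairwise (fun i j => Disjoint (f i : Set E) (f j)) ∧
      (Set.univ.pi fun i => (f i : Set E)) ⊆ U}
  refine ⟨insert (U ∩ {p | ¬ Function.Injective p}) T,
    ((Set.to_countable _).image _).insert _, ?_, ?_⟩
  · rintro A (rfl | ⟨f, hf, rfl⟩)
    · exact Or.inl ⟨hU.measurableSet.inter measurableSet_not_injective, fun p hp => hp.2⟩
    · exact Or.inr ⟨fun i => f i, fun i => (hb.isOpen (f i).2).measurableSet, hf.1, rfl⟩
  · ext p
    constructor
    · rintro ⟨A, rfl | ⟨f, hf, rfl⟩, hp⟩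
      · exact hp.1
      · exact hf.2 hp
    · intro hp
      by_cases hinj : Function.Injective p
      -- Distinct coordinates have disjoint neighbourhoods, which can be shrunk to basic open sets
      -- whose product stays inside `U`.
      · obtain ⟨V, hV, hdisj⟩ := (Set.finite_range p).t2_separation
        obtain ⟨u, hu, huU⟩ := isOpen_pi_iff'.1 hU p hp
        choose g hg hpg hgu using fun i => hb.exists_subset_of_mem_open
          (show p i ∈ u i ∩ V (p i) from ⟨(hu i).2, (hV _).1⟩) ((hu i).1.inter (hV _).2)
        refine ⟨_, Or.inr ⟨fun i => ⟨g i, hg i⟩, ⟨fun i j hij => ?_, fun q hq => huU ?_⟩, rfl⟩, ?_⟩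
        · exact (hdisj ⟨i, rfl⟩ ⟨j, rfl⟩ (hinj.ne hij)).mono
            ((hgu i).trans Set.inter_subset_right) ((hgu j).trans Set.inter_subset_right)
        · exact fun i _ => (hgu i (hq i trivial)).1
        · exact fun i _ => hpg i
      · exact ⟨_, Or.inl rfl, hp, hinj⟩

/-- On rectangles with disjoint sides the tuple count is a product of independent counts, and on
non-injective families it vanishes. Since these sets generate, such computations determine measures
on all families. -/
lemma generateFrom_offDiagSystem [Finite ι] :
    (MeasurableSpace.pi : MeasurableSpace (ι → E)) =
      MeasurableSpace.generateFrom (offDiagSystem ι E) := by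
  refine le_antisymm ?_ (MeasurableSpace.generateFrom_le
    fun A hA => measurableSet_of_mem_offDiagSystem hA)
  rw [BorelSpace.measurable_eq (α := ι → E)]
  refine MeasurableSpace.generateFrom_le fun U hU => ?_
  obtain ⟨T, hT, hTs, rfl⟩ := exists_countable_offDiagSystem_cover hU
  exact MeasurableSet.sUnion hT fun A hA => MeasurableSpace.measurableSet_generateFrom (hTs hA)

lemma pi_not_injective [Fintype ι] (Λ : Measure E) [SigmaFinite Λ] [NullSingletonClass Λ] :
    Measure.pi (fun _ : ι => Λ) {p | ¬ Function.Injective p} = 0 := by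
  classical
  have : {p : ι → E | ¬ Function.Injective p} =
      ⋃ (i : ι) (j : ι) (_ : i ≠ j), {p | p i = p j} := by
    ext p
    simp [Function.Injective]
    grind
  rw [this]
  simp only [measure_iUnion_null_iff]
  intro i j hij
  have hm : MeasurableSet {p : ι → E | p i = p j} :=
    (isClosed_eq (continuous_apply i) (continuous_apply j)).measurableSet
  by_cases hE : Nonempty E
  swap
  · have : IsEmpty (ι → E) := ⟨fun p => hE ⟨p i⟩⟩
    simp [Set.eq_empty_of_isEmpty]
  -- Integrate the `i`-th coordinate first: its section is the singleton `{x j}`, which is null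
  -- because `Λ` is diffuse.
  rw [← lintegral_indicator_one hm,
    lintegral_eq_lmarginal_univ (μ := fun _ => Λ) (fun _ => hE.some),
    lmarginal_erase' _ (measurable_one.indicator hm) (Finset.mem_univ i)]
  have h0 : (fun x : ι → E => ∫⁻ y, {p : ι → E | p i = p j}.indicator 1
      (Function.update x i y) ∂Λ) = 0 := by
    ext x
    have : (fun y => {p : ι → E | p i = p j}.indicator (1 : (ι → E) → ENNReal)
        (Function.update x i y)) = ({x j} : Set E).indicator 1 := by
      ext y
      simp [Set.indicator, Function.update_of_ne hij.symm]
    rw [this, lintegral_indicator_one (measurableSet_singleton _)]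
    simp
  rw [h0]
  simp [lmarginal]

end FactorialMeasure

/-! ### Factorial moments of a Poisson process -/

lemma lintegral_natCast_poissonMeasure (a : NNReal) :
    ∫⁻ n : ℕ, (n : ENNReal) ∂poissonMeasure a = a := by
  -- Index shift: n + 1 times the weight of n + 1 is `a` times the weight of n.
  have key : ∀ n : ℕ, ENNReal.ofReal (Real.exp (-a) * a ^ (n + 1) / (n + 1).factorial) *
      ((n + 1 : ℕ) : ENNReal) =
      a * ENNReal.ofReal (Real.exp (-a) * a ^ n / n.factorial) := by
    intro n
    rw [← ENNReal.ofReal_natCast (n + 1), ← ENNReal.ofReal_coe_nnreal (p := a),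
      ← ENNReal.ofReal_mul (by positivity), ← ENNReal.ofReal_mul (by positivity)]
    congr 1
    rw [Nat.factorial_succ]
    push_cast
    field_simp
    ring
  have hone : ∑' n : ℕ, ENNReal.ofReal (Real.exp (-a) * a ^ n / n.factorial) = 1 := by
    have := measure_univ (μ := poissonMeasure a)
    simpa [poissonMeasure, Measure.sum_apply] using this
  simp only [poissonMeasure, lintegral_sum_measure, lintegral_smul_measure, lintegral_dirac,
    smul_eq_mul]
  rw [tsum_eq_zero_add' ENNReal.summable]
  simp only [key, ENNReal.tsum_mul_left, hone]
  simp

section FactorialMoments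

variable {E ι Ω : Type*}

/-- Disjoint sides make injectivity automatic, so the tuples form a Cartesian product. -/
lemma encard_univ_pi_inter_injTuples [Fintype ι] {V : Set E} (hV : V.Finite) {B : ι → Set E}
    (hB : Pairwise (fun i j => Disjoint (B i) (B j))) :
    ((Set.univ.pi B ∩ injTuples ι V).encard : ENNReal) =
      ∏ i, ((V ∩ B i).encard : ENNReal) := by
  classical
  have hf : ∀ i, (V ∩ B i).Finite := fun i => hV.inter_of_left _
  have : Set.univ.pi B ∩ injTuples ι V = (Fintype.piFinset fun i => (hf i).toFinset : Finset _) := by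
    ext p
    simp only [injTuples, Set.mem_inter_iff, Set.mem_univ_pi, Set.mem_ofPred_eq, Finset.mem_coe,
      Fintype.mem_piFinset, Set.Finite.mem_toFinset]
    refine ⟨fun h i => ⟨h.2.2 i, h.1 i⟩, fun h => ⟨fun i => (h i).2, ?_, fun i => (h i).1⟩⟩
    intro i j hij
    by_contra hne
    exact Set.disjoint_left.1 (hB hne) (h i).2 (hij ▸ (h j).2)
  rw [this, Set.encard_coe_eq_coe_finsetCard, Fintype.card_piFinset]
  simp only [(hf _).encard_eq_coe_toFinset_card, ENat.toENNReal_coe]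
  push_cast
  rfl

lemma encard_injTuples [Fintype ι] {V : Set E} (hV : V.Finite) :
    (injTuples ι V).encard = (V.encard.toNat.descFactorial (Fintype.card ι) : ℕ) := by
  classical
  have := hV.fintype
  let e : injTuples ι V ≃ (ι ↪ V) :=
    { toFun := fun p => ⟨fun i => ⟨p.1 i, p.2.2 i⟩, fun i j h => p.2.1 (Subtype.ext_iff.1 h)⟩
      invFun := fun f => ⟨fun i => f i, fun i j h => f.injective (Subtype.ext h), fun i => (f i).2⟩
      left_inv := fun _ => rfl
      right_inv := fun _ => rfl }
  rw [Set.encard, ENat.card_congr e, ENat.card_eq_coe_fintype_card, Fintype.card_embedding_eq,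
    Set.encard, ENat.card_eq_coe_fintype_card]
  rfl

/-- The counting measure on the families of pairwise distinct points of `V`. -/
noncomputable def tupleMeasure (ι : Type*) [MeasurableSpace E] (V : Set E) : Measure (ι → E) :=
  Measure.count.restrict (injTuples ι V)

variable [MeasurableSpace Ω] [MeasurableSpace E] {P : Measure Ω} {Λ : Measure E} {η : Ω → Set E}

lemma IsPoissonProcess.lintegral_encard (h : IsPoissonProcess P Λ η) {B : Set E}
    (hB : MeasurableSet B) (hfin : Λ B ≠ ⊤) :
    ∫⁻ ω, ((η ω ∩ B).encard : ENNReal) ∂P = Λ B := by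
  have := (h.hasLaw_count B hB hfin).lintegral_comp (f := fun n : ℕ∞ => (n : ENNReal))
    (measurable_from_top.aemeasurable)
  rw [this, lintegral_map measurable_from_top measurable_from_top]
  simp [lintegral_natCast_poissonMeasure, ENNReal.coe_toNNReal hfin]

lemma IsPoissonProcess.iIndepFun_count [Fintype ι] (h : IsPoissonProcess P Λ η) {B : ι → Set E}
    (hB : ∀ i, MeasurableSet (B i)) (hd : Pairwise (fun i j => Disjoint (B i) (B j))) :
    iIndepFun (fun i ω => (η ω ∩ B i).encard) P := by
  let e := Fintype.equivFin ι
  have := h.indep_count _ (fun k => B (e.symm k)) (fun k => hB _)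
    (fun k l hkl => hd (e.symm.injective.ne hkl))
  have := this.precomp (g := e) e.injective
  simpa using this

/-- A Poisson process with finite intensity measure agrees almost surely with one all of whose
realisations are finite. -/
lemma IsPoissonProcess.exists_finite [IsFiniteMeasure Λ] (h : IsPoissonProcess P Λ η) :
    ∃ η' : Ω → Set E, IsPoissonProcess P Λ η' ∧ (∀ ω, (η' ω).Finite) ∧ ∀ᵐ ω ∂P, η' ω = η ω := by
  classical
  have hfin : ∀ᵐ ω ∂P, (η ω).Finite := by
    have := h.lintegral_encard .univ (measure_ne_top Λ _)
    have hlt := ae_lt_top ((measurable_from_top (f := fun n : ℕ∞ => (n : ENNReal))).comp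
      (h.measurable_count _ .univ)) (by
        change ∫⁻ ω, ((η ω ∩ Set.univ).encard : ENNReal) ∂P ≠ ⊤
        rw [this]; exact measure_ne_top _ _)
    filter_upwards [hlt] with ω hω
    simp only [Function.comp_apply, Set.inter_univ] at hω
    rw [← Set.encard_lt_top_iff]
    simpa using hω
  -- The value on the null event of infinite realisations is immaterial; that event is measurable as
  -- the event of total count `⊤`, so the counts remain measurable.
  let η' : Ω → Set E := fun ω => if (η ω).Finite then η ω else ∅
  have hae : ∀ᵐ ω ∂P, η' ω = η ω := by
    filter_upwards [hfin] with ω hω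
    simp [η', hω]
  have hcount : ∀ B : Set E, (fun ω => (η' ω ∩ B).encard) =ᵐ[P] fun ω => (η ω ∩ B).encard := by
    intro B
    filter_upwards [hae] with ω hω
    rw [hω]
  refine ⟨η', ⟨fun B hB => ?_, fun B hB hB' => (h.hasLaw_count B hB hB').congr (hcount B),
    fun n B hB hd => (iIndepFun_congr fun i => hcount (B i)).2 (h.indep_count n B hB hd)⟩,
    fun ω => ?_, hae⟩
  · have hms : MeasurableSet {ω | (η ω).Finite} := by
      have : {ω | (η ω).Finite} = (fun ω => (η ω ∩ Set.univ).encard) ⁻¹' {⊤}ᶜ := by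
        ext ω; simp
      rw [this]
      exact h.measurable_count _ .univ (measurableSet_singleton _).compl
    have : (fun ω => (η' ω ∩ B).encard) =
        fun ω => if (η ω).Finite then (η ω ∩ B).encard else 0 := by
      ext ω
      by_cases hω : (η ω).Finite <;> simp [η', hω]
    rw [this]
    exact Measurable.ite hms (h.measurable_count B hB) measurable_const
  · by_cases hω : (η ω).Finite <;> simp [η', hω]

variable [TopologicalSpace E] [SecondCountableTopology E] [T2Space E] [BorelSpace E]

lemma tupleMeasure_apply [Finite ι] {V : Set E} (hV : V.Finite) {A : Set (ι → E)}
    (hA : MeasurableSet A) : tupleMeasure ι V A = ((A ∩ injTuples ι V).encard : ENNReal) := by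
  rw [tupleMeasure, Measure.restrict_apply hA,
    Measure.count_apply (hA.inter (injTuples_finite hV).measurableSet)]

lemma measurable_tupleMeasure [Fintype ι] (h : IsPoissonProcess P Λ η) (hη : ∀ ω, (η ω).Finite) :
    Measurable fun ω => tupleMeasure ι (η ω) := by
  have hc : ∀ B : Set E, MeasurableSet B →
      Measurable fun ω => ((η ω ∩ B).encard : ENNReal) := fun B hB =>
    (measurable_from_top (f := fun n : ℕ∞ => (n : ENNReal))).comp (h.measurable_count B hB)
  have huniv : ∀ ω, tupleMeasure ι (η ω) Set.univ =
      (((η ω ∩ Set.univ).encard.toNat.descFactorial (Fintype.card ι) : ℕ) : ENNReal) := by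
    intro ω
    rw [tupleMeasure_apply (hη ω) .univ, Set.univ_inter, encard_injTuples (hη ω), Set.inter_univ]
    simp
  have : ∀ ω, IsFiniteMeasure (tupleMeasure ι (η ω)) := fun ω => ⟨by
    rw [huniv]; exact ENNReal.natCast_lt_top _⟩
  refine Measurable.measure_of_isPiSystem generateFrom_offDiagSystem isPiSystem_offDiagSystem ?_ ?_
  · intro A hA
    have hm := measurableSet_of_mem_offDiagSystem hA
    simp only [tupleMeasure_apply (hη _) hm]
    rcases hA with hA | ⟨B, hB, hd, rfl⟩
    · have : ∀ ω, A ∩ injTuples ι (η ω) = ∅ := fun ω =>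
        Set.eq_empty_of_forall_notMem fun p hp => hA.2 p hp.1 hp.2.1
      simp [this]
    · simp only [encard_univ_pi_inter_injTuples (hη _) hd]
      exact Finset.measurable_fun_prod _ fun i _ => hc _ (hB i)
  · simp only [huniv]
    exact (measurable_from_top (f := fun n : ℕ∞ =>
      ((n.toNat.descFactorial (Fintype.card ι) : ℕ) : ENNReal))).comp
      (h.measurable_count _ .univ)

/-- The factorial moment measures of a Poisson process are the powers of its intensity measure. -/
theorem lintegral_tupleMeasure [Fintype ι] [IsFiniteMeasure Λ] [NullSingletonClass Λ]
    (h : IsPoissonProcess P Λ η) (hη : ∀ ω, (η ω).Finite) {A : Set (ι → E)}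
    (hA : MeasurableSet A) :
    ∫⁻ ω, tupleMeasure ι (η ω) A ∂P = Measure.pi (fun _ : ι => Λ) A := by
  have hmeas := measurable_tupleMeasure (ι := ι) h hη
  rw [← Measure.bind_apply hA hmeas.aemeasurable]
  -- Both sides are measures in `A`, so it is enough to compare them on the generating π-system.
  suffices hs : Measure.pi (fun _ : ι => Λ) = P.bind fun ω => tupleMeasure ι (η ω) by rw [hs]
  obtain ⟨T, hTc, hTs, hTU⟩ := exists_countable_offDiagSystem_cover (ι := ι) (E := E) isOpen_univ
  refine Measure.ext_of_generateFrom_of_cover_subset generateFrom_offDiagSystem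
    isPiSystem_offDiagSystem hTs hTc hTU (fun _ _ => measure_ne_top _ _) fun A hA => ?_
  have hm := measurableSet_of_mem_offDiagSystem hA
  rw [Measure.bind_apply hm hmeas.aemeasurable]
  simp only [tupleMeasure_apply (hη _) hm]
  rcases hA with hA | ⟨B, hB, hd, rfl⟩
  · have : ∀ ω, A ∩ injTuples ι (η ω) = ∅ := fun ω =>
      Set.eq_empty_of_forall_notMem fun p hp => hA.2 p hp.1 hp.2.1
    simp only [this]
    simpa using measure_mono_null hA.2 (pi_not_injective Λ)
  -- On a rectangle both sides are products of the masses `Λ (B i)`, by independence of the counts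
  -- in disjoint sets.
  · simp only [encard_univ_pi_inter_injTuples (hη _) hd, Measure.pi_pi]
    have hi := (h.iIndepFun_count hB hd).comp (fun _ n => (n : ENNReal))
      (fun _ => measurable_from_top)
    rw [lintegral_prod_eq_prod_lintegral_of_indepFun Finset.univ
      (fun i ω => ((η ω ∩ B i).encard : ENNReal)) hi
      (fun i => (measurable_from_top (f := fun n : ℕ∞ => (n : ENNReal))).comp
        (h.measurable_count _ (hB i)))]
    exact Finset.prod_congr rfl fun i _ => (h.lintegral_encard (hB i) (measure_ne_top _ _)).symm

end FactorialMoments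

/-! ### Pairs of tuples sorted by their common points -/

section PairDecomposition

variable {E ι Ω : Type*} [DecidableEq ι]

/-- The family obtained from `s` by taking the points of `K` from the second part of `s` and the
other points, relabelled by `σ`, from the first part. -/
def glueTuple (K : Finset ι) (σ : ι → ι) (s : ι ⊕ K → E) : ι → E :=
  Function.updateFinset (fun i => s (.inl (σ i))) K fun k => s (.inr k)

/-- The families whose first part lies in `A` and whose glued family lies in `B`. -/
def glueSet (K : Finset ι) (σ : ι → ι) (A B : Set (ι → E)) : Set (ι ⊕ K → E) :=
  {s | (fun i => s (.inl i)) ∈ A ∧ glueTuple K σ s ∈ B}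

/-- The index pairs used for decomposing pairs of families according to their common points. -/
def gluePatterns (ι : Type*) [DecidableEq ι] [Fintype ι] : Finset (Finset ι × (ι → ι)) :=
  {c | (c.1 = Finset.univ → c.2 = id) ∧ ∀ i ∉ c.1, ∀ j ∉ c.1, c.2 i = c.2 j → i = j}

/-- Take `K` to be the positions where q leaves the range of p, and let σ locate the other entries
in p. The cover overlaps, since σ is largely free on `K`; this costs only a constant, as an upper
bound is all that is wanted. -/
lemma prod_injTuples_subset [Fintype ι] (V : Set E) (A B : Set (ι → E)) :
    (A ∩ injTuples ι V) ×ˢ (B ∩ injTuples ι V) ⊆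
      ⋃ c ∈ gluePatterns ι, (fun s => (fun i => s (.inl i), glueTuple c.1 c.2 s)) ''
        (glueSet c.1 c.2 A B ∩ injTuples (ι ⊕ c.1) V) := by
  classical
  rintro ⟨p, q⟩ ⟨⟨hpA, hp, hpV⟩, ⟨hqB, hq, hqV⟩⟩
  let K : Finset ι := {j | q j ∉ Set.range p}
  have hK : ∀ j, j ∉ K → ∃ i, p i = q j := fun j hj => by simpa [K] using hj
  -- The default value on `K` is the identity, so that the disjoint pairs fall under the single
  -- pattern `(univ, id)` and the product of the means is counted once.
  let σ : ι → ι := fun j => if h : j ∈ K then j else (hK j h).choose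
  have hσ : ∀ j, j ∉ K → p (σ j) = q j := fun j hj => by
    simp only [σ, hj, dif_neg, not_false_eq_true]
    exact (hK j hj).choose_spec
  let s : ι ⊕ K → E := Sum.elim p fun k => q k
  have hglue : glueTuple K σ s = q := by
    ext1 j
    by_cases hj : j ∈ K
    · simp [glueTuple, Function.updateFinset, hj, s]
    · simp [glueTuple, Function.updateFinset, hj, s, hσ]
  refine Set.mem_iUnion₂.2 ⟨(K, σ), ?_, s, ⟨⟨hpA, ?_⟩, ?_, ?_⟩, ?_⟩
  · simp only [gluePatterns, Finset.mem_filter, Finset.mem_univ, true_and]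
    refine ⟨fun hu => ?_, fun i hi j hj hij => hq ?_⟩
    · ext1 j
      simp [σ, hu]
    · exact (hσ i hi).symm.trans ((congrArg p hij).trans (hσ j hj))
  · rwa [hglue]
  · refine hp.sumElim (hq.comp Subtype.val_injective) fun i k h => ?_
    have := k.2
    simp only [K, Finset.mem_filter] at this
    exact this.2 ⟨i, h⟩
  · rintro (i | k)
    · exact hpV i
    · exact hqV k
  · simp only [hglue]
    rfl

variable [MeasurableSpace Ω] [MeasurableSpace E] {P : Measure Ω} {Λ : Measure E} {η : Ω → Set E}

lemma measurable_glueTuple (K : Finset ι) (σ : ι → ι) :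
    Measurable (glueTuple K σ : (ι ⊕ K → E) → ι → E) := by
  refine measurable_pi_iff.2 fun j => ?_
  by_cases hj : j ∈ K
  · simp only [glueTuple, Function.updateFinset, hj, dif_pos]
    exact measurable_pi_apply _
  · simp only [glueTuple, Function.updateFinset, hj, dif_neg, not_false_eq_true]
    exact measurable_pi_apply _

lemma measurableSet_glueSet (K : Finset ι) (σ : ι → ι) {A B : Set (ι → E)}
    (hA : MeasurableSet A) (hB : MeasurableSet B) : MeasurableSet (glueSet K σ A B) :=
  ((measurable_pi_iff.2 fun _ => measurable_pi_apply _) hA).inter (measurable_glueTuple K σ hB)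

/-- Fubini: with p fixed, the new coordinates of the glued tuple are integrated out while its old
ones are read off from `p ∘ σ`. -/
lemma pi_glueSet [Fintype ι] [SigmaFinite Λ] (K : Finset ι) (σ : ι → ι) {A B : Set (ι → E)}
    (hA : MeasurableSet A) (hB : MeasurableSet B) :
    Measure.pi (fun _ : ι ⊕ K => Λ) (glueSet K σ A B) =
      ∫⁻ p in A, (∫⋯∫⁻_K, B.indicator 1 ∂fun _ => Λ) (p ∘ σ) ∂Measure.pi fun _ : ι => Λ := by
  have hm := measurableSet_glueSet K σ hA hB
  rw [← (measurePreserving_sumPiEquivProdPi_symm fun _ : ι ⊕ K => Λ).measure_preimage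
    hm.nullMeasurableSet, Measure.prod_apply ((MeasurableEquiv.measurable _) hm),
    ← lintegral_indicator hA]
  refine lintegral_congr fun p => ?_
  by_cases hp : p ∈ A
  · have hset : Prod.mk p ⁻¹' ((MeasurableEquiv.sumPiEquivProdPi fun _ : ι ⊕ K => E).symm ⁻¹'
        glueSet K σ A B) = (fun u => Function.updateFinset (p ∘ σ) K u) ⁻¹' B := by
      ext u
      exact ⟨fun h => h.2, fun h => ⟨hp, h⟩⟩
    rw [hset, Set.indicator_of_mem hp, lmarginal, ← lintegral_indicator_one
      (measurable_updateFinset hB)]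
    rfl
  · have hset : Prod.mk p ⁻¹' ((MeasurableEquiv.sumPiEquivProdPi fun _ : ι ⊕ K => E).symm ⁻¹'
        glueSet K σ A B) = ∅ :=
      Set.eq_empty_of_forall_notMem fun u h => hp h.1
    rw [hset, Set.indicator_of_notMem hp, measure_empty]

variable [TopologicalSpace E] [SecondCountableTopology E] [T2Space E] [BorelSpace E]

lemma tupleMeasure_mul_le [Fintype ι] {V : Set E} (hV : V.Finite) {A B : Set (ι → E)}
    (hA : MeasurableSet A) (hB : MeasurableSet B) :
    tupleMeasure ι V A * tupleMeasure ι V B ≤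
      ∑ c ∈ gluePatterns ι, tupleMeasure (ι ⊕ c.1) V (glueSet c.1 c.2 A B) := by
  simp only [tupleMeasure_apply hV hA, tupleMeasure_apply hV hB,
    tupleMeasure_apply hV (measurableSet_glueSet _ _ hA hB)]
  rw [← ENat.toENNReal_mul, ← Set.encard_prod]
  have h := (Set.encard_le_encard (prod_injTuples_subset V A B)).trans
    ((gluePatterns ι).set_encard_biUnion_le _)
  have h' := h.trans (Finset.sum_le_sum fun c _ => Set.encard_image_le _ _)
  have := ENat.toENNReal_le.2 h'
  rwa [show ∀ f : Finset ι × (ι → ι) → ℕ∞, ((∑ c ∈ gluePatterns ι, f c : ℕ∞) : ENNReal) =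
    ∑ c ∈ gluePatterns ι, (f c : ENNReal) from fun f => map_sum ENat.toENNRealRingHom f _] at this

/-- A second moment bound for the numbers of families in `A` and in `B`, with the term of disjoint
families separated from the terms of families with common points. -/
theorem lintegral_tupleMeasure_mul_le [Fintype ι] [IsFiniteMeasure Λ] [NullSingletonClass Λ]
    (h : IsPoissonProcess P Λ η) (hη : ∀ ω, (η ω).Finite) {A B : Set (ι → E)}
    (hA : MeasurableSet A) (hB : MeasurableSet B) :
    ∫⁻ ω, tupleMeasure ι (η ω) A * tupleMeasure ι (η ω) B ∂P ≤
      Measure.pi (fun _ : ι => Λ) A * Measure.pi (fun _ : ι => Λ) B +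
      ∑ c ∈ gluePatterns ι with c.1 ≠ Finset.univ,
        ∫⁻ p in A, (∫⋯∫⁻_c.1, B.indicator 1 ∂fun _ => Λ) (p ∘ c.2)
          ∂Measure.pi fun _ : ι => Λ := by
  refine (lintegral_mono fun ω => tupleMeasure_mul_le (hη ω) hA hB).trans ?_
  rw [lintegral_finsetSum' _ fun c _ => ((Measure.measurable_coe
    (measurableSet_glueSet c.1 c.2 hA hB)).comp
      (measurable_tupleMeasure h hη)).aemeasurable]
  simp only [lintegral_tupleMeasure h hη (measurableSet_glueSet _ _ hA hB), pi_glueSet _ _ hA hB]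
  have hsplit : gluePatterns ι = insert (Finset.univ, id)
      ({c ∈ gluePatterns ι | c.1 ≠ Finset.univ}) := by
    ext ⟨K, σ⟩
    simp only [gluePatterns, Finset.mem_filter, Finset.mem_univ, true_and, Finset.mem_insert,
      Prod.mk.injEq]
    by_cases hK : K = Finset.univ <;> simp [hK]
  have hsum := Finset.sum_insert (f := fun c : Finset ι × (ι → ι) => ∫⁻ p in A,
    (∫⋯∫⁻_c.1, B.indicator 1 ∂fun _ => Λ) (p ∘ c.2) ∂Measure.pi fun _ : ι => Λ)
    (show ((Finset.univ, id) : Finset ι × (ι → ι)) ∉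
      ({c ∈ gluePatterns ι | c.1 ≠ Finset.univ} : Finset _) by simp)
  rw [← hsplit] at hsum
  rw [hsum]
  refine add_le_add (le_of_eq ?_) le_rfl
  simp [lintegral_indicator_one hB, mul_comm]

end PairDecomposition

/-! ### Projections along a direction, cylinders and transversality -/

lemma inner_rotate (Q : Matrix.specialOrthogonalGroup (Fin 3) ℝ) (u v : E3) :
    inner ℝ (rotate Q u) (rotate Q v) = inner ℝ u v := by
  have hQ : (Q : Matrix (Fin 3) (Fin 3) ℝ).transpose * (Q : Matrix (Fin 3) (Fin 3) ℝ) = 1 :=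
    (Matrix.mem_orthogonalGroup_iff' _ _).1 (Matrix.mem_specialOrthogonalGroup_iff.1 Q.2).1
  have h : LinearMap.adjoint (rotate Q) (rotate Q v) = v := by
    rw [rotate, ← Matrix.toEuclideanLin_conjTranspose_eq_adjoint]
    simp [Matrix.toLpLin_apply, hQ]
  rw [← LinearMap.adjoint_inner_right, h]

lemma rotate_surjective (Q : Matrix.specialOrthogonalGroup (Fin 3) ℝ) :
    Function.Surjective (rotate Q) := by
  refine LinearMap.injective_iff_surjective.1 fun u v h => ?_
  rw [← sub_eq_zero, ← inner_self_eq_zero (𝕜 := ℝ), ← inner_rotate Q, map_sub, h, sub_self,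
    inner_zero_left]

lemma mem_refPlane_of_apply_two_eq_zero {w : E3} (hw : w 2 = 0) : w ∈ refPlane := by
  refine Submodule.mem_span_pair.2 ⟨w 0, w 1, ?_⟩
  ext i
  fin_cases i <;> simp [hw]

lemma apply_two_eq_zero_of_mem_refPlane {w : E3} (hw : w ∈ refPlane) : w 2 = 0 := by
  obtain ⟨a, b, rfl⟩ := Submodule.mem_span_pair.1 hw
  simp

/-- The component of `v` orthogonal to `x`. -/
noncomputable def perp (x v : E3) : E3 := v - inner ℝ x v • x

lemma perp_sub (x u v : E3) : perp x (u - v) = perp x u - perp x v := by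
  simp only [perp, inner_sub_right, sub_smul]
  abel

lemma perp_neg (x v : E3) : perp x (-v) = - perp x v := by
  simp only [perp, inner_neg_right, neg_smul]
  abel

lemma continuous_perp (x : E3) : Continuous (perp x) := by
  unfold perp
  fun_prop

lemma norm_perp_le {x : E3} (hx : ‖x‖ = 1) (v : E3) : ‖perp x v‖ ≤ ‖v‖ := by
  have h : ‖perp x v‖ ^ 2 = ‖v‖ ^ 2 - inner ℝ x v ^ 2 := by
    rw [perp, norm_sub_sq_real, norm_smul, hx, inner_smul_right, real_inner_comm]
    simp
    ring
  nlinarith [norm_nonneg v, norm_nonneg (perp x v), sq_nonneg (inner ℝ x v)]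

/-- A rotation preserves orthogonality, so the plane is the orthogonal complement of x. From here on
the choice of θ plays no role. -/
lemma starProjection_plane {θ : Sphere2 → Matrix.specialOrthogonalGroup (Fin 3) ℝ} {x : Sphere2}
    (hθ : rotate (θ x) (EuclideanSpace.single 2 1) = (x : E3)) (v : E3) :
    (plane θ x).starProjection v = perp x v := by
  have hx : inner ℝ (x : E3) (x : E3) = 1 := by simp
  refine Submodule.eq_starProjection_of_mem_orthogonal ?_ ?_
  · obtain ⟨w, hw⟩ := rotate_surjective (θ x) (perp x v)
    refine ⟨w, mem_refPlane_of_apply_two_eq_zero ?_, hw⟩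
    have h := inner_rotate (θ x) (EuclideanSpace.single 2 1) w
    rw [hθ, hw, EuclideanSpace.inner_single_left] at h
    simpa [perp, inner_sub_right, inner_smul_right, hx] using h.symm
  · rw [Submodule.mem_orthogonal']
    rintro _ ⟨w, hw, rfl⟩
    have h := inner_rotate (θ x) (EuclideanSpace.single 2 1) w
    rw [hθ, EuclideanSpace.inner_single_left, apply_two_eq_zero_of_mem_refPlane hw] at h
    simp only [perp, sub_sub_cancel, inner_smul_left, h]
    simp

/-- In an orthonormal basis starting with x, the cylinder lies in a box with sides 2H, 2ρ, 2ρ. -/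
lemma volume_cylinder_le {x : E3} (hx : ‖x‖ = 1) {H ρ : ℝ} (hH : 0 ≤ H) (hρ : 0 ≤ ρ) :
    volume {v : E3 | |inner ℝ x v| ≤ H ∧ ‖perp x v‖ ≤ ρ} ≤ ENNReal.ofReal (8 * H * ρ ^ 2) := by
  have hortho : Orthonormal ℝ (({0} : Set (Fin 3)).domRestrict fun _ => x) :=
    ⟨fun _ => hx, fun i j hij => (hij (Subsingleton.elim i j)).elim⟩
  obtain ⟨b, hb⟩ := hortho.exists_orthonormalBasis_extension_of_card_eq (by simp)
  have hb0 : b 0 = x := hb 0 rfl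
  let I : Fin 3 → Set ℝ := ![Set.Icc (-H) H, Set.Icc (-ρ) ρ, Set.Icc (-ρ) ρ]
  have hI : ∀ i, MeasurableSet (I i) := fun i => by fin_cases i <;> exact measurableSet_Icc
  have hcoord : ∀ i, i ≠ 0 → ∀ v, |inner ℝ (b i) v| ≤ ‖perp x v‖ := by
    intro i hi v
    have : inner ℝ (b i) v = inner ℝ (b i) (perp x v) := by
      rw [perp, inner_sub_right, inner_smul_right, ← hb0, b.orthonormal.2 hi]
      simp
    rw [this]
    simpa [b.orthonormal.1 i] using abs_real_inner_le_norm (b i) (perp x v)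
  have hsub : {v : E3 | |inner ℝ x v| ≤ H ∧ ‖perp x v‖ ≤ ρ} ⊆
      (fun v => (b.repr v).ofLp) ⁻¹' Set.univ.pi I := by
    rintro v ⟨h1, h2⟩ i -
    change (b.repr v).ofLp i ∈ I i
    rw [b.repr_apply_apply]
    fin_cases i
    · simpa [I, hb0, abs_le] using h1
    · exact abs_le.1 ((hcoord 1 (by decide) v).trans h2)
    · exact abs_le.1 ((hcoord 2 (by decide) v).trans h2)
  have hmp : MeasurePreserving (fun v => (b.repr v).ofLp) (volume : Measure E3) volume :=
    (EuclideanSpace.volume_preserving_symm_measurableEquiv_toLp (Fin 3)).symm.symm.comp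
      b.measurePreserving_repr
  refine (measure_mono hsub).trans ?_
  rw [hmp.measure_preimage (MeasurableSet.univ_pi hI).nullMeasurableSet, volume_pi,
    Measure.pi_pi, Fin.prod_univ_three]
  simp only [I, Matrix.cons_val_zero, Matrix.cons_val_one, Matrix.cons_val, Real.volume_Icc]
  rw [← ENNReal.ofReal_mul (by linarith), ← ENNReal.ofReal_mul (by nlinarith)]
  exact ENNReal.ofReal_le_ofReal (by nlinarith)

/-- The left side is the distance from the component of v along x to the line spanned by y, hence at
most the distance between the components of v along x and along y. That difference is also a
difference of perpendicular parts. -/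
lemma abs_inner_mul_sin_angle_le {x y : E3} (hx : ‖x‖ = 1) (hy : ‖y‖ = 1) (v : E3) :
    |inner ℝ x v| * Real.sin (InnerProductGeometry.angle x y) ≤ ‖perp x v‖ + ‖perp y v‖ := by
  set a := inner ℝ x v
  set b := inner ℝ y v
  have hc : Real.cos (InnerProductGeometry.angle x y) = inner ℝ x y := by
    rw [InnerProductGeometry.cos_angle, hx, hy]; simp
  have h1 : ‖a • x - b • y‖ ≤ ‖perp x v‖ + ‖perp y v‖ := by
    have : a • x - b • y = perp y v - perp x v := by simp only [perp, a, b]; abel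
    rw [this, add_comm]
    exact norm_sub_le _ _
  have h2 : ‖a • x - b • y‖ ^ 2 = a ^ 2 - 2 * (a * b * inner ℝ x y) + b ^ 2 := by
    rw [norm_sub_sq_real, norm_smul, norm_smul, hx, hy, inner_smul_left, inner_smul_right]
    simp
    ring
  have hs := Real.sin_sq_add_cos_sq (InnerProductGeometry.angle x y)
  rw [hc] at hs
  refine le_trans (abs_le_of_sq_le_sq' ?_ (norm_nonneg _)).2 h1
  rw [mul_pow, sq_abs, h2]
  -- With c the cosine of the angle, ‖ax - by‖² = a²(1 - c²) + (ac - b)².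
  nlinarith [sq_nonneg (a * inner ℝ x y - b)]

/-! ### Intensity of balls, tubes and intersections of tubes -/

section Intensity

variable {z : E3} {R t : ℝ}

lemma intensity_sub_preimage_le (ht : 0 ≤ t) (c : E3) (S : Set E3) {a : ℝ}
    (hS : volume S ≤ ENNReal.ofReal a) :
    (ENNReal.ofReal t • volume.restrict (Metric.closedBall z R)) {y | y - c ∈ S} ≤
      ENNReal.ofReal (t * a) := by
  rw [Measure.smul_apply, smul_eq_mul, ENNReal.ofReal_mul ht]
  gcongr
  refine (Measure.restrict_apply_le _ _).trans ?_
  have : {y | y - c ∈ S} = (fun y => y + (-c)) ⁻¹' S := by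
    ext y; simp [sub_eq_add_neg]
  rwa [this, measure_preimage_add_right]

lemma intensity_ball_le (ht : 0 ≤ t) {ρ : ℝ} (hρ : 0 ≤ ρ) (c : E3) :
    (ENNReal.ofReal t • volume.restrict (Metric.closedBall z R)) {y | ‖y - c‖ ≤ ρ} ≤
      ENNReal.ofReal (t * (8 * ρ ^ 3)) := by
  refine intensity_sub_preimage_le ht c {v | ‖v‖ ≤ ρ} ?_
  have he : ‖(EuclideanSpace.single 0 1 : E3)‖ = 1 := by simp
  refine (measure_mono fun v hv => ?_).trans
    ((volume_cylinder_le he hρ hρ).trans_eq (by ring_nf))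
  refine ⟨?_, (norm_perp_le he v).trans hv⟩
  refine (abs_real_inner_le_norm _ _).trans ?_
  rw [he, one_mul]
  exact hv

/-- The tube is unbounded, but inside the window heights along x differ from that of the centre z by
at most R. Moving c along x to the height of z leaves the tube unchanged. -/
lemma intensity_tube_le (ht : 0 ≤ t) (hR : 0 ≤ R) {x : E3} (hx : ‖x‖ = 1) {ρ : ℝ} (hρ : 0 ≤ ρ)
    (c : E3) :
    (ENNReal.ofReal t • volume.restrict (Metric.closedBall z R)) {y | ‖perp x (y - c)‖ ≤ ρ} ≤
      ENNReal.ofReal (t * (8 * R * ρ ^ 2)) := by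
  have hW : (ENNReal.ofReal t • volume.restrict (Metric.closedBall z R)) (Metric.closedBall z R)ᶜ
      = 0 := by
    rw [Measure.smul_apply, Measure.restrict_apply measurableSet_closedBall.compl]
    simp
  have hxx : inner ℝ x x = 1 := by rw [real_inner_self_eq_norm_sq, hx]; norm_num
  refine le_trans ?_ (intensity_sub_preimage_le (z := z) (R := R) ht (c + inner ℝ x (z - c) • x) _
    (volume_cylinder_le hx hR hρ))
  rw [← measure_inter_add_sdiff _ measurableSet_closedBall (t := Metric.closedBall z R)]
  rw [measure_mono_null (Set.sdiff_subset_compl _ _) hW, add_zero]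
  refine measure_mono fun y hy => ?_
  obtain ⟨h1, h2⟩ := hy
  have e1 : inner ℝ x (y - (c + inner ℝ x (z - c) • x)) = inner ℝ x (y - z) := by
    simp only [inner_sub_right, inner_add_right, inner_smul_right, hxx]
    ring
  have e2 : perp x (y - (c + inner ℝ x (z - c) • x)) = perp x (y - c) := by
    rw [← sub_sub, perp_sub]
    simp [perp, inner_smul_right, hx]
  refine ⟨?_, ?_⟩
  · rw [e1]
    refine (abs_real_inner_le_norm _ _).trans ?_
    rw [hx, one_mul]
    simpa [dist_eq_norm] using h2
  · rw [e2]
    exact h1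

/-- Transversality bounds the height along x by (ρ + ρ')/δ. This replaces R in the bound for a
single tube and gains a factor of order ρ/δ. -/
lemma intensity_tube_inter_tube_le (ht : 0 ≤ t) {x y : E3} (hx : ‖x‖ = 1) (hy : ‖y‖ = 1)
    {δ : ℝ} (hδ : 0 < δ) (hxy : δ ≤ Real.sin (InnerProductGeometry.angle x y)) {ρ ρ' : ℝ}
    (hρ : 0 ≤ ρ) (hρ' : 0 ≤ ρ') (c : E3) :
    (ENNReal.ofReal t • volume.restrict (Metric.closedBall z R))
        {w | ‖perp x (w - c)‖ ≤ ρ ∧ ‖perp y (w - c)‖ ≤ ρ'} ≤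
      ENNReal.ofReal (t * (8 * ((ρ + ρ') / δ) * ρ ^ 2)) := by
  refine intensity_sub_preimage_le ht c {v | ‖perp x v‖ ≤ ρ ∧ ‖perp y v‖ ≤ ρ'} ?_
  refine (measure_mono fun v hv => ?_).trans
    (volume_cylinder_le hx (H := (ρ + ρ') / δ) (by positivity) hρ)
  obtain ⟨h1, h2⟩ := hv
  refine ⟨?_, h1⟩
  rw [le_div_iff₀ hδ]
  have := abs_inner_mul_sin_angle_le hx hy v
  have := mul_le_mul_of_nonneg_left hxy (abs_nonneg (inner ℝ x v))
  linarith

end Intensity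

/-! ### Integrating out one point at a time -/

section Marginals

variable {ι E : Type*} [DecidableEq ι] [MeasurableSpace E] {Λ : Measure E} [SigmaFinite Λ]

/-- Integrating out one coordinate of the indicator function of `S`, if `S` constrains that
coordinate by `T` and the other ones by `S'`. -/
lemma lmarginal_indicator_insert_le {s : Finset ι} {i : ι} (hi : i ∉ s) {S T S' : Set (ι → E)}
    (hS : MeasurableSet S) (hT : MeasurableSet T) (hST : S ⊆ T ∩ S')
    (hS' : ∀ x y, Function.update x i y ∈ S' → x ∈ S') {C : ENNReal} (hC : C ≠ ⊤)
    (hTC : ∀ x, Λ {y | Function.update x i y ∈ T} ≤ C) (x : ι → E) :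
    (∫⋯∫⁻_insert i s, S.indicator 1 ∂fun _ => Λ) x ≤
      C * (∫⋯∫⁻_s, S'.indicator 1 ∂fun _ => Λ) x := by
  rw [lmarginal_insert' _ (measurable_one.indicator hS) hi]
  unfold lmarginal
  rw [← lintegral_const_mul' _ _ hC]
  refine lintegral_mono fun u => ?_
  set w := Function.updateFinset x s u
  have hm : MeasurableSet {y | Function.update w i y ∈ T} := measurable_update w hT
  by_cases hw : w ∈ S'
  · refine le_trans (lintegral_mono (g := {y | Function.update w i y ∈ T}.indicator 1)
      fun y => ?_) ?_
    · by_cases hy : Function.update w i y ∈ S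
      · have : y ∈ {y | Function.update w i y ∈ T} := (hST hy).1
        simp [hy, this]
      · simp [hy]
    · rw [lintegral_indicator_one hm]
      simpa [hw] using hTC w
  · have : ∀ y, Function.update w i y ∉ S := fun y hy => hw (hS' w y (hST hy).2)
    simp [this]

lemma lmarginal_indicator_singleton_le {i : ι} {S T : Set (ι → E)}
    (hS : MeasurableSet S) (hT : MeasurableSet T) (hST : S ⊆ T) {C : ENNReal} (hC : C ≠ ⊤)
    (hTC : ∀ x, Λ {y | Function.update x i y ∈ T} ≤ C) (x : ι → E) :
    (∫⋯∫⁻_{i}, S.indicator 1 ∂fun _ => Λ) x ≤ C := by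
  have := lmarginal_indicator_insert_le (Finset.notMem_empty i) hS hT
    (S' := Set.univ) (by simpa using hST) (fun _ _ _ => trivial) hC hTC x
  simpa using this

end Marginals

/-! ### Crossing tuples and their marginals -/

/-- The tuples whose `i`-th and `j`-th points have distance at most `ρ`. -/
def ballSet (ρ : ℝ) (i j : Fin 4) : Set (Fin 4 → E3) := {q | ‖q i - q j‖ ≤ ρ}

/-- The tuples for which the projections of the `i`-th and `j`-th points along `x` have distance
at most `ρ`. -/
def tubeSet (x : E3) (ρ : ℝ) (i j : Fin 4) : Set (Fin 4 → E3) := {q | ‖perp x (q i - q j)‖ ≤ ρ}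

/-- The other end of the edge to which a point belongs. -/
def partner : Fin 4 → Fin 4 := ![1, 0, 3, 2]

/-- The tuples whose edges `{p 0, p 1}` and `{p 2, p 3}` have length at most `r` and cross in the
projection onto `L`. -/
def crossSet (r : ℝ) (L : Submodule ℝ E3) : Set (Fin 4 → E3) :=
  {p | ‖p 0 - p 1‖ ≤ r ∧ ‖p 2 - p 3‖ ≤ r ∧ (crossing L p).Nonempty}

lemma measurableSet_ballSet (ρ : ℝ) (i j : Fin 4) : MeasurableSet (ballSet ρ i j) :=
  (isClosed_le (by fun_prop) continuous_const).measurableSet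

lemma measurableSet_tubeSet (x : E3) (ρ : ℝ) (i j : Fin 4) : MeasurableSet (tubeSet x ρ i j) :=
  (isClosed_le ((continuous_perp x).comp (by fun_prop)).norm continuous_const).measurableSet

lemma mem_ballSet_of_update {ρ : ℝ} {i j k : Fin 4} (hi : i ≠ k) (hj : j ≠ k) (q : Fin 4 → E3)
    (y : E3) (h : Function.update q k y ∈ ballSet ρ i j) : q ∈ ballSet ρ i j := by
  simpa [ballSet, Function.update_of_ne hi, Function.update_of_ne hj] using h

lemma mem_tubeSet_of_update {x : E3} {ρ : ℝ} {i j k : Fin 4} (hi : i ≠ k) (hj : j ≠ k)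
    (q : Fin 4 → E3) (y : E3) (h : Function.update q k y ∈ tubeSet x ρ i j) :
    q ∈ tubeSet x ρ i j := by
  simpa [tubeSet, Function.update_of_ne hi, Function.update_of_ne hj] using h

/-- The parameters of the two meeting points range over the compact square [0,1]², and projecting a
closed set along a compact factor gives a closed set. -/
lemma isClosed_crossSet (r : ℝ) (L : Submodule ℝ E3) : IsClosed (crossSet r L) := by
  let F : Set ((unitInterval × unitInterval) × (Fin 4 → E3)) :=
    {a | L.starProjection ((1 - (a.1.1 : ℝ)) • a.2 0 + (a.1.1 : ℝ) • a.2 1) =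
      L.starProjection ((1 - (a.1.2 : ℝ)) • a.2 2 + (a.1.2 : ℝ) • a.2 3)}
  have hF : IsClosed F := isClosed_eq (by fun_prop) (by fun_prop)
  have hset : crossSet r L =
      {p | ‖p 0 - p 1‖ ≤ r} ∩ ({p | ‖p 2 - p 3‖ ≤ r} ∩ Prod.snd '' F) := by
    ext p
    refine and_congr Iff.rfl (and_congr Iff.rfl ?_)
    simp only [crossing, projSegment, segment_eq_image]
    constructor
    · rintro ⟨_, ⟨_, ⟨a, ha, rfl⟩, rfl⟩, ⟨_, ⟨b, hb, rfl⟩, h⟩⟩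
      exact ⟨((⟨a, ha⟩, ⟨b, hb⟩), p), h.symm, rfl⟩
    · rintro ⟨⟨⟨a, b⟩, p⟩, h, rfl⟩
      exact ⟨_, ⟨_, ⟨a, a.2, rfl⟩, rfl⟩, ⟨_, ⟨b, b.2, rfl⟩, Eq.symm h⟩⟩
  rw [hset]
  exact (isClosed_le (by fun_prop) continuous_const).inter
    ((isClosed_le (by fun_prop) continuous_const).inter
      (isClosedMap_snd_of_compactSpace F hF))

lemma crossSet_subset_ballSet {r : ℝ} {L : Submodule ℝ E3} (i : Fin 4) :
    crossSet r L ⊆ ballSet r i (partner i) := by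
  rintro p ⟨h1, h2, -⟩
  fin_cases i
  · exact h1
  · exact (norm_sub_rev _ _).trans_le h1
  · exact h2
  · exact (norm_sub_rev _ _).trans_le h2

/-- Each endpoint is within r of the point of its edge lying over the crossing, and these two points
have the same projection. -/
lemma crossSet_subset_tubeSet {r : ℝ} {L : Submodule ℝ E3} {x : E3} (hx : ‖x‖ = 1)
    (hL : ∀ v, L.starProjection v = perp x v) {i j : Fin 4} (hij : i ≠ j) :
    crossSet r L ⊆ tubeSet x (2 * r) i j := by
  have hsymm : ∀ (p : Fin 4 → E3) i j, ‖perp x (p i - p j)‖ = ‖perp x (p j - p i)‖ := by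
    intro p i j
    rw [← neg_sub, perp_neg, norm_neg]
  have hseg : ∀ {a u v : E3}, a ∈ segment ℝ u v → ‖u - v‖ ≤ r → ‖u - a‖ ≤ r ∧ ‖v - a‖ ≤ r := by
    intro a u v ha huv
    rw [← dist_eq_norm] at huv
    have := dist_add_dist_of_mem_segment ha
    rw [← dist_eq_norm, ← dist_eq_norm, dist_comm v a]
    exact ⟨by linarith [dist_nonneg (x := a) (y := v)], by linarith [dist_nonneg (x := u) (y := a)]⟩
  rintro p ⟨h1, h2, _, ⟨a, ha, rfl⟩, ⟨b, hb, hab⟩⟩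
  have hr : 0 ≤ r := (norm_nonneg _).trans h1
  rw [hL, hL] at hab
  have hcross : ∀ {u v : E3}, ‖u - a‖ ≤ r → ‖v - b‖ ≤ r → ‖perp x (u - v)‖ ≤ 2 * r := by
    intro u v hu hv
    have : perp x (u - v) = perp x (u - a) - perp x (v - b) := by
      simp only [perp_sub, hab]
      abel
    rw [this]
    have h1 := norm_sub_le (perp x (u - a)) (perp x (v - b))
    have h2 := norm_perp_le hx (u - a)
    have h3 := norm_perp_le hx (v - b)
    linarith
  obtain ⟨ha0, ha1⟩ := hseg ha h1
  obtain ⟨hb2, hb3⟩ := hseg hb h2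
  have h01 : ‖perp x (p 0 - p 1)‖ ≤ 2 * r := by linarith [norm_perp_le hx (p 0 - p 1)]
  have h23 : ‖perp x (p 2 - p 3)‖ ≤ 2 * r := by linarith [norm_perp_le hx (p 2 - p 3)]
  have h02 := hcross ha0 hb2
  have h03 := hcross ha0 hb3
  have h12 := hcross ha1 hb2
  have h13 := hcross ha1 hb3
  change ‖perp x (p i - p j)‖ ≤ 2 * r
  fin_cases i <;> fin_cases j <;> first | exact absurd rfl hij | assumption | (rw [hsymm]; assumption)

lemma partner_ne (i : Fin 4) : partner i ≠ i := by revert i; decide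

section MarginalBounds

variable {Λ : Measure E3} {x : E3} {ρ : ℝ} {b τ : ENNReal}

lemma measure_update_ballSet_le (hb : ∀ c, Λ {y | ‖y - c‖ ≤ ρ} ≤ b) {i j : Fin 4} (hij : i ≠ j)
    (q : Fin 4 → E3) : Λ {y | Function.update q i y ∈ ballSet ρ i j} ≤ b := by
  simpa [ballSet, Function.update_of_ne hij.symm] using hb (q j)

lemma measure_update_tubeSet_le (hτ : ∀ c, Λ {y | ‖perp x (y - c)‖ ≤ ρ} ≤ τ) {i j : Fin 4}
    (hij : i ≠ j) (q : Fin 4 → E3) : Λ {y | Function.update q i y ∈ tubeSet x ρ i j} ≤ τ := by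
  simpa [tubeSet, Function.update_of_ne hij.symm] using hτ (q j)

variable [SigmaFinite Λ] {r : ℝ} {L : Submodule ℝ E3}

lemma lmarginal_crossSet_le_of_card_one (hbt : b ≠ ⊤) (hb : ∀ c, Λ {y | ‖y - c‖ ≤ r} ≤ b)
    {K : Finset (Fin 4)} (hK : K.card = 1) (q : Fin 4 → E3) :
    (∫⋯∫⁻_K, (crossSet r L).indicator 1 ∂fun _ => Λ) q ≤ b := by
  obtain ⟨i, rfl⟩ := Finset.card_eq_one.1 hK
  exact lmarginal_indicator_singleton_le (isClosed_crossSet r L).measurableSet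
    (measurableSet_ballSet r i (partner i)) (crossSet_subset_ballSet i) hbt
    (measure_update_ballSet_le hb (partner_ne i).symm) q

lemma lmarginal_crossSet_le_of_card_two (hx : ‖x‖ = 1) (hL : ∀ v, L.starProjection v = perp x v)
    (hbt : b ≠ ⊤) (hb : ∀ c, Λ {y | ‖y - c‖ ≤ r} ≤ b) (hτt : τ ≠ ⊤)
    (hτ : ∀ c, Λ {y | ‖perp x (y - c)‖ ≤ 2 * r} ≤ τ)
    {K : Finset (Fin 4)} (hK : K.card = 2) (q : Fin 4 → E3) :
    (∫⋯∫⁻_K, (crossSet r L).indicator 1 ∂fun _ => Λ) q ≤ b * τ + b * b := by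
  have hcomb : ∀ K : Finset (Fin 4), K.card = 2 →
      -- Either a whole edge is new, giving a ball around the partner and a tube around an old
      -- point, or each edge has one new point, giving two balls around old points.
      (∃ i k, K = {i, partner i} ∧ k ≠ i ∧ k ≠ partner i) ∨
      ∃ i j, K = {i, j} ∧ i ≠ j ∧ partner i ≠ j ∧ partner j ≠ i := by decide
  rcases hcomb K hK with ⟨i, k, rfl, hki, hkp⟩ | ⟨i, j, rfl, hij, hpi, hpj⟩
  · refine le_trans ?_ le_self_add
    refine (lmarginal_indicator_insert_le (by simpa using (partner_ne i).symm)
      (isClosed_crossSet r L).measurableSet (measurableSet_ballSet r i (partner i))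
      (S' := tubeSet x (2 * r) (partner i) k)
      (Set.subset_inter (crossSet_subset_ballSet i) (crossSet_subset_tubeSet hx hL hkp.symm))
      (mem_tubeSet_of_update (partner_ne i) hki) hbt
      (measure_update_ballSet_le hb (partner_ne i).symm) q).trans ?_
    gcongr
    exact lmarginal_indicator_singleton_le (measurableSet_tubeSet _ _ _ _)
      (measurableSet_tubeSet _ _ _ _) le_rfl hτt (measure_update_tubeSet_le hτ hkp.symm) q
  · refine le_trans ?_ le_add_self
    refine (lmarginal_indicator_insert_le (by simpa using hij)
      (isClosed_crossSet r L).measurableSet (measurableSet_ballSet r i (partner i))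
      (S' := ballSet r j (partner j))
      (Set.subset_inter (crossSet_subset_ballSet i) (crossSet_subset_ballSet j))
      (mem_ballSet_of_update hij.symm hpj) hbt
      (measure_update_ballSet_le hb (partner_ne i).symm) q).trans ?_
    gcongr
    exact lmarginal_indicator_singleton_le (measurableSet_ballSet _ _ _)
      (measurableSet_ballSet _ _ _) le_rfl hbt
      (measure_update_ballSet_le hb (partner_ne j).symm) q

/-- The only old point is `partner i`. It confines `i` to a ball and one end of the other edge to a
tube; the remaining end lies in a ball around that one. -/
lemma lmarginal_crossSet_le_of_card_three (hx : ‖x‖ = 1)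
    (hL : ∀ v, L.starProjection v = perp x v)
    (hbt : b ≠ ⊤) (hb : ∀ c, Λ {y | ‖y - c‖ ≤ r} ≤ b) (hτt : τ ≠ ⊤)
    (hτ : ∀ c, Λ {y | ‖perp x (y - c)‖ ≤ 2 * r} ≤ τ)
    {K : Finset (Fin 4)} (hK : K.card = 3) (q : Fin 4 → E3) :
    (∫⋯∫⁻_K, (crossSet r L).indicator 1 ∂fun _ => Λ) q ≤ b * (b * τ) := by
  have hcomb : ∀ K : Finset (Fin 4), K.card = 3 →
      ∃ i j, K = {i, j, partner j} ∧ i ≠ j ∧ i ≠ partner j ∧ partner i ≠ j ∧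
        partner i ≠ partner j := by decide
  obtain ⟨i, j, rfl, hij, hipj, hpij, hpp⟩ := hcomb K hK
  refine (lmarginal_indicator_insert_le (by simp [hij, hipj])
    (isClosed_crossSet r L).measurableSet (measurableSet_ballSet r i (partner i))
    (S' := ballSet r j (partner j) ∩ tubeSet x (2 * r) (partner j) (partner i))
    (Set.subset_inter (crossSet_subset_ballSet i) (Set.subset_inter (crossSet_subset_ballSet j)
      (crossSet_subset_tubeSet hx hL hpp.symm)))
    (fun q y h => ⟨mem_ballSet_of_update hij.symm hipj.symm q y h.1,
      mem_tubeSet_of_update hipj.symm (partner_ne i) q y h.2⟩) hbt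
    (measure_update_ballSet_le hb (partner_ne i).symm) q).trans ?_
  gcongr
  refine (lmarginal_indicator_insert_le (by simpa using (partner_ne j).symm)
    ((measurableSet_ballSet _ _ _).inter (measurableSet_tubeSet _ _ _ _))
    (measurableSet_ballSet r j (partner j)) le_rfl
    (mem_tubeSet_of_update (partner_ne j) hpij) hbt
    (measure_update_ballSet_le hb (partner_ne j).symm) q).trans ?_
  gcongr
  exact lmarginal_indicator_singleton_le (measurableSet_tubeSet _ _ _ _)
    (measurableSet_tubeSet _ _ _ _) le_rfl hτt (measure_update_tubeSet_le hτ hpp.symm) q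

/-- A bound for the measure of the crossing tuples under a constraint `U` on the points `p 0` and
`p 2`. -/
lemma pi_crossSet_inter_le (hbt : b ≠ ⊤) (hb : ∀ c, Λ {y | ‖y - c‖ ≤ r} ≤ b)
    (hΛ : Λ Set.univ ≠ ⊤) {U : Set (Fin 4 → E3)} (hU : MeasurableSet U)
    (hU1 : ∀ q y, Function.update q 1 y ∈ U → q ∈ U)
    (hU3 : ∀ q y, Function.update q 3 y ∈ U → q ∈ U) (hτt : τ ≠ ⊤)
    (hτ : ∀ q, Λ {y | Function.update q 2 y ∈ U} ≤ τ) :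
    Measure.pi (fun _ : Fin 4 => Λ) (crossSet r L ∩ U) ≤ b * (b * (τ * Λ Set.univ)) := by
  have hm : MeasurableSet (crossSet r L ∩ U) := (isClosed_crossSet r L).measurableSet.inter hU
  rw [← lintegral_indicator_one hm, lintegral_eq_lmarginal_univ (μ := fun _ => Λ) (fun _ => 0),
    -- Order of integration: points 1 and 3 in balls around their partners, then point 2 under the
    -- constraint `U`, and finally point 0 over the whole window.
    show (Finset.univ : Finset (Fin 4)) = {1, 3, 2, 0} by decide]
  refine (lmarginal_indicator_insert_le (by decide) hm (measurableSet_ballSet r 1 0)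
    (S' := ballSet r 3 2 ∩ U)
    (fun q hq => ⟨crossSet_subset_ballSet 1 hq.1, crossSet_subset_ballSet 3 hq.1, hq.2⟩)
    (fun q y h => ⟨mem_ballSet_of_update (by decide) (by decide) q y h.1, hU1 q y h.2⟩) hbt
    (measure_update_ballSet_le hb (by decide)) _).trans ?_
  gcongr
  refine (lmarginal_indicator_insert_le (by decide) ((measurableSet_ballSet _ _ _).inter hU)
    (measurableSet_ballSet r 3 2) le_rfl hU3 hbt
    (measure_update_ballSet_le hb (by decide)) _).trans ?_
  gcongr
  refine (lmarginal_indicator_insert_le (by decide) hU hU (S' := Set.univ) (by simp)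
    (fun _ _ _ => trivial) hτt hτ _).trans ?_
  gcongr
  exact lmarginal_indicator_singleton_le .univ .univ le_rfl hΛ (by simp) _

end MarginalBounds

/-- At least three positions are old and σ is injective on them, so their images cannot all fit in a
single edge. -/
lemma exists_mem_edges_of_injOn {K : Finset (Fin 4)} (hK : K.card ≤ 1) {σ : Fin 4 → Fin 4}
    (hσ : ∀ i ∉ K, ∀ j ∉ K, σ i = σ j → i = j) :
    ∃ i ∉ K, ∃ j ∉ K, (σ i = 0 ∨ σ i = 1) ∧ (σ j = 2 ∨ σ j = 3) := by
  have hc : 3 ≤ Kᶜ.card := by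
    rw [Finset.card_compl, Fintype.card_fin]
    omega
  have hinj : Set.InjOn σ (Kᶜ : Finset (Fin 4)) := fun i hi j hj h =>
    hσ i (by simpa using hi) j (by simpa using hj) h
  have key : ∀ e : Finset (Fin 4), e.card = 2 → ∃ i ∉ K, σ i ∉ e := by
    intro e he
    by_contra! hcon
    have := Finset.card_le_card_of_injOn σ
      (fun i hi => hcon i (by simpa using hi)) hinj
    omega
  obtain ⟨i, hi, hi'⟩ := key {2, 3} rfl
  obtain ⟨j, hj, hj'⟩ := key {0, 1} rfl
  refine ⟨i, hi, j, hj, ?_, ?_⟩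
  · generalize σ i = a at hi'
    revert hi'
    fin_cases a <;> simp
  · generalize σ j = a at hj'
    revert hj'
    fin_cases a <;> simp

/-- A point shared with each edge of p is within r of `p 0`, respectively `p 2`, and the two shared
points are 2r-close after projection along y: 4r = r + 2r + r. -/
lemma mem_tubeSet_of_glue {r : ℝ} {L L' : Submodule ℝ E3} {y : E3} (hy : ‖y‖ = 1)
    (hL' : ∀ v, L'.starProjection v = perp y v) {K : Finset (Fin 4)} (hK : K.card ≤ 1)
    {σ : Fin 4 → Fin 4} (hσ : ∀ i ∉ K, ∀ j ∉ K, σ i = σ j → i = j) {p : Fin 4 → E3}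
    (hp : p ∈ crossSet r L) {u : K → E3}
    (hq : Function.updateFinset (p ∘ σ) K u ∈ crossSet r L') : p ∈ tubeSet y (4 * r) 2 0 := by
  obtain ⟨i, hi, j, hj, hi', hj'⟩ := exists_mem_edges_of_injOn hK hσ
  have hij : j ≠ i := by
    rintro rfl
    omega
  have h := crossSet_subset_tubeSet hy hL' hij hq
  have hr : 0 ≤ r := (norm_nonneg _).trans hp.1
  have h0 : ‖p (σ i) - p 0‖ ≤ r := by
    rcases hi' with h | h <;> rw [h]
    · simpa using hr
    · exact crossSet_subset_ballSet 1 hp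
  have h2 : ‖p 2 - p (σ j)‖ ≤ r := by
    rcases hj' with h | h <;> rw [h]
    · simpa using hr
    · exact crossSet_subset_ballSet 2 hp
  have hsplit : perp y (p 2 - p 0) =
      perp y (p 2 - p (σ j)) + perp y (p (σ j) - p (σ i)) + perp y (p (σ i) - p 0) := by
    simp only [perp_sub]
    abel
  change ‖perp y (p 2 - p 0)‖ ≤ 4 * r
  rw [hsplit]
  refine norm_add₃_le.trans ?_
  have h0' := norm_perp_le hy (p (σ i) - p 0)
  have h2' := norm_perp_le hy (p 2 - p (σ j))
  have h' : ‖perp y (p (σ j) - p (σ i))‖ ≤ 2 * r := by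
    simpa [tubeSet, Function.updateFinset, hi, hj] using h
  linarith

/-! ### Mixed second moments of crossing counts -/

section SecondMoments

variable {Λ : Measure E3} [IsFiniteMeasure Λ] {x y : E3} {b τ D : ENNReal} {r : ℝ}
  {L L' : Submodule ℝ E3}

/-- The contribution to the mixed second moment of the pairs of crossings with common points of a
given pattern. -/
lemma lintegral_glue_crossSet_le (hx : ‖x‖ = 1) (hL : ∀ v, L.starProjection v = perp x v)
    (hy : ‖y‖ = 1) (hL' : ∀ v, L'.starProjection v = perp y v)
    (hbt : b ≠ ⊤) (hb : ∀ c, Λ {w | ‖w - c‖ ≤ r} ≤ b) (hτt : τ ≠ ⊤)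
    (hτ : ∀ c, Λ {w | ‖perp x (w - c)‖ ≤ 2 * r} ≤ τ)
    (hτ' : ∀ c, Λ {w | ‖perp y (w - c)‖ ≤ 2 * r} ≤ τ) (hDt : D ≠ ⊤)
    (hD : ∀ c, Λ {w | ‖perp x (w - c)‖ ≤ 2 * r ∧ ‖perp y (w - c)‖ ≤ 4 * r} ≤ D)
    {c : Finset (Fin 4) × (Fin 4 → Fin 4)} (hc : c ∈ gluePatterns (Fin 4))
    (hc' : c.1 ≠ Finset.univ) :
    ∫⁻ p in crossSet r L, (∫⋯∫⁻_c.1, (crossSet r L').indicator 1 ∂fun _ => Λ) (p ∘ c.2)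
        ∂Measure.pi (fun _ : Fin 4 => Λ) ≤
      (b * (b * τ) + (b * τ + b * b)) * (b * (b * (τ * Λ Set.univ))) +
        (1 + b) * (b * (b * (D * Λ Set.univ))) := by
  obtain ⟨K, σ⟩ := c
  have hmA := (isClosed_crossSet r L).measurableSet
  have hcard : K.card < 4 := by
    have := Finset.card_lt_card (Finset.ssubset_univ_iff.2 hc')
    simpa using this
  rcases Nat.lt_or_ge 1 K.card with h1 | h1
  -- Two or three new points: bound the inner marginal uniformly, then use the measure of the
  -- crossing tuples.
  · refine le_trans ?_ le_self_add
    have hbound : ∀ q, (∫⋯∫⁻_K, (crossSet r L').indicator 1 ∂fun _ => Λ) q ≤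
        b * (b * τ) + (b * τ + b * b) := by
      intro q
      obtain h | h : K.card = 2 ∨ K.card = 3 := by omega
      · exact (lmarginal_crossSet_le_of_card_two hy hL' hbt hb hτt hτ' h q).trans le_add_self
      · exact (lmarginal_crossSet_le_of_card_three hy hL' hbt hb hτt hτ' h q).trans le_self_add
    refine (lintegral_mono fun p => hbound _).trans ?_
    rw [setLIntegral_const]
    gcongr
    have h2 := pi_crossSet_inter_le (L := L) hbt hb (measure_ne_top Λ _)
      (measurableSet_tubeSet x (2 * r) 2 0)
      (mem_tubeSet_of_update (by decide) (by decide))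
      (mem_tubeSet_of_update (by decide) (by decide)) hτt
      (measure_update_tubeSet_le hτ (by decide))
    rwa [Set.inter_eq_left.2 (crossSet_subset_tubeSet hx hL (by decide))] at h2
  · refine le_trans ?_ le_add_self
    have hσ : ∀ i ∉ K, ∀ j ∉ K, σ i = σ j → i = j := by
      simp only [gluePatterns, Finset.mem_filter] at hc
      exact hc.2.2
    have hbound : ∀ q, (∫⋯∫⁻_K, (crossSet r L').indicator 1 ∂fun _ => Λ) q ≤ 1 + b := by
      intro q
      obtain h | h : K.card = 0 ∨ K.card = 1 := by omega
      · rw [Finset.card_eq_zero.1 h, lmarginal_empty]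
        exact (Set.indicator_le_self' (fun _ _ => zero_le_one) q).trans le_self_add
      · exact (lmarginal_crossSet_le_of_card_one hbt hb h q).trans le_add_self
    have hmT := measurableSet_tubeSet y (4 * r) 2 0
    -- At most one new point: the inner marginal vanishes unless p lies in the tube along y, and
    -- there it is at most 1 + b.
    have hstep : ∫⁻ p in crossSet r L, (∫⋯∫⁻_K, (crossSet r L').indicator 1 ∂fun _ => Λ) (p ∘ σ)
        ∂Measure.pi (fun _ : Fin 4 => Λ) ≤
        ∫⁻ p in crossSet r L, (tubeSet y (4 * r) 2 0).indicator (fun _ => 1 + b) p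
          ∂Measure.pi (fun _ : Fin 4 => Λ) := by
      refine setLIntegral_mono (measurable_const.indicator hmT) fun p hp => ?_
      by_cases hpT : p ∈ tubeSet y (4 * r) 2 0
      · rw [Set.indicator_of_mem hpT]
        exact hbound _
      · have : ∀ u : K → E3, (crossSet r L').indicator (1 : (Fin 4 → E3) → ENNReal)
            (Function.updateFinset (p ∘ σ) K u) = 0 := fun u =>
          Set.indicator_of_notMem (fun h => hpT (mem_tubeSet_of_glue hy hL' h1 hσ hp h)) _
        simp [lmarginal, this]
    refine hstep.trans ?_
    rw [lintegral_indicator_const hmT, Measure.restrict_apply hmT]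
    gcongr
    have h2 := pi_crossSet_inter_le (L := L) (τ := D) hbt hb (measure_ne_top Λ _)
      ((measurableSet_tubeSet x (2 * r) 2 0).inter hmT)
      (fun q w h => ⟨mem_tubeSet_of_update (by decide) (by decide) q w h.1,
        mem_tubeSet_of_update (by decide) (by decide) q w h.2⟩)
      (fun q w h => ⟨mem_tubeSet_of_update (by decide) (by decide) q w h.1,
        mem_tubeSet_of_update (by decide) (by decide) q w h.2⟩) hDt
      (fun q => by simpa [tubeSet] using hD (q 0))
    refine (measure_mono fun p hp => ?_).trans h2
    exact ⟨hp.2, crossSet_subset_tubeSet hx hL (by decide) hp.2, hp.1⟩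

variable {Ω : Type*} [MeasurableSpace Ω] {P : Measure Ω} {η : Ω → Set E3}

lemma lintegral_tupleMeasure_crossSet_mul_le [NullSingletonClass Λ]
    (h : IsPoissonProcess P Λ η) (hη : ∀ ω, (η ω).Finite)
    (hx : ‖x‖ = 1) (hL : ∀ v, L.starProjection v = perp x v)
    (hy : ‖y‖ = 1) (hL' : ∀ v, L'.starProjection v = perp y v)
    (hbt : b ≠ ⊤) (hb : ∀ c, Λ {w | ‖w - c‖ ≤ r} ≤ b) (hτt : τ ≠ ⊤)
    (hτ : ∀ c, Λ {w | ‖perp x (w - c)‖ ≤ 2 * r} ≤ τ)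
    (hτ' : ∀ c, Λ {w | ‖perp y (w - c)‖ ≤ 2 * r} ≤ τ) (hDt : D ≠ ⊤)
    (hD : ∀ c, Λ {w | ‖perp x (w - c)‖ ≤ 2 * r ∧ ‖perp y (w - c)‖ ≤ 4 * r} ≤ D) :
    ∫⁻ ω, tupleMeasure (Fin 4) (η ω) (crossSet r L) *
        tupleMeasure (Fin 4) (η ω) (crossSet r L') ∂P ≤
      (∫⁻ ω, tupleMeasure (Fin 4) (η ω) (crossSet r L) ∂P) *
        (∫⁻ ω, tupleMeasure (Fin 4) (η ω) (crossSet r L') ∂P) +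
      (gluePatterns (Fin 4)).card * ((b * (b * τ) + (b * τ + b * b)) *
        (b * (b * (τ * Λ Set.univ))) + (1 + b) * (b * (b * (D * Λ Set.univ)))) := by
  have hm := (isClosed_crossSet r L).measurableSet
  have hm' := (isClosed_crossSet r L').measurableSet
  rw [lintegral_tupleMeasure h hη hm, lintegral_tupleMeasure h hη hm']
  refine (lintegral_tupleMeasure_mul_le h hη hm hm').trans ?_
  gcongr
  refine (Finset.sum_le_card_nsmul _ _ _ fun c hc => lintegral_glue_crossSet_le hx hL hy hL'
    hbt hb hτt hτ hτ' hDt hD (Finset.mem_filter.1 hc).1 (Finset.mem_filter.1 hc).2).trans ?_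
  rw [nsmul_eq_mul]
  gcongr
  exact Finset.filter_subset _ _

end SecondMoments

/-! ### From extended nonnegative moments to covariances -/

section Covariance

variable {Ω : Type*} [MeasurableSpace Ω] {P : Measure Ω}

lemma memLp_two_toReal {N : Ω → ENNReal} (hN : Measurable N)
    (h2 : ∫⁻ ω, N ω * N ω ∂P ≠ ⊤) : MemLp (fun ω => (N ω).toReal) 2 P := by
  rw [memLp_two_iff_integrable_sq hN.ennreal_toReal.aestronglyMeasurable]
  simpa only [← sq, ENNReal.toReal_pow] using
    integrable_toReal_of_lintegral_ne_top (hN.fun_mul hN).aemeasurable h2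

lemma covariance_toReal_le [IsProbabilityMeasure P] {N N' : Ω → ENNReal} (hN : Measurable N)
    (hN' : Measurable N') (hfin : ∀ ω, N ω ≠ ⊤) (hfin' : ∀ ω, N' ω ≠ ⊤)
    (h2 : ∫⁻ ω, N ω * N ω ∂P ≠ ⊤) (h2' : ∫⁻ ω, N' ω * N' ω ∂P ≠ ⊤) {β : ℝ} (hβ : 0 ≤ β)
    (h : ∫⁻ ω, N ω * N' ω ∂P ≤ (∫⁻ ω, N ω ∂P) * (∫⁻ ω, N' ω ∂P) + ENNReal.ofReal β) :
    cov[fun ω => (N ω).toReal, fun ω => (N' ω).toReal; P] ≤ β := by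
  have hm := memLp_two_toReal hN h2
  have hm' := memLp_two_toReal hN' h2'
  have hne : ∀ {M : Ω → ENNReal}, Measurable M → (∀ ω, M ω ≠ ⊤) → ∫⁻ ω, M ω * M ω ∂P ≠ ⊤ →
      ∫⁻ ω, M ω ∂P ≠ ⊤ := by
    intro M hM hMf hM2
    have hi := (memLp_two_toReal hM hM2).integrable one_le_two
    have := hi.lintegral_lt_top
    simp only [ENNReal.ofReal_toReal (hMf _)] at this
    exact this.ne
  rw [covariance_eq_sub hm hm']
  have e1 : ∫ ω, (N ω).toReal ∂P = (∫⁻ ω, N ω ∂P).toReal :=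
    integral_toReal hN.aemeasurable (ae_of_all _ fun ω => (hfin ω).lt_top)
  have e2 : ∫ ω, (N' ω).toReal ∂P = (∫⁻ ω, N' ω ∂P).toReal :=
    integral_toReal hN'.aemeasurable (ae_of_all _ fun ω => (hfin' ω).lt_top)
  have e3 : ∫ ω, (N ω).toReal * (N' ω).toReal ∂P = (∫⁻ ω, N ω * N' ω ∂P).toReal := by
    rw [← integral_toReal (hN.fun_mul hN').aemeasurable
      (ae_of_all _ fun ω => (ENNReal.mul_ne_top (hfin ω) (hfin' ω)).lt_top)]
    simp only [ENNReal.toReal_mul]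
  have hprod : (∫⁻ ω, N ω ∂P) * (∫⁻ ω, N' ω ∂P) ≠ ⊤ :=
    ENNReal.mul_ne_top (hne hN hfin h2) (hne hN' hfin' h2')
  have h' := ENNReal.toReal_mono (ENNReal.add_ne_top.2 ⟨hprod, ENNReal.ofReal_ne_top⟩) h
  rw [ENNReal.toReal_add hprod ENNReal.ofReal_ne_top, ENNReal.toReal_mul,
    ENNReal.toReal_ofReal hβ] at h'
  simp only [Pi.mul_apply, e1, e2, e3]
  linarith

lemma covariance_congr_ae {X X' Y Y' : Ω → ℝ} (hX : X =ᵐ[P] X') (hY : Y =ᵐ[P] Y') :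
    cov[X, Y; P] = cov[X', Y'; P] := by
  simp only [covariance, integral_congr_ae hX, integral_congr_ae hY]
  refine integral_congr_ae ?_
  filter_upwards [hX, hY] with ω h1 h2
  rw [h1, h2]

end Covariance

/-- Projections onto L lie in L, so the requirement that the crossing be contained in L is vacuous.
-/
lemma crossingCount_eq_toReal_tupleMeasure {V : Set E3} (hV : V.Finite) (r : ℝ)
    (L : Submodule ℝ E3) :
    crossingCount V r L L = 1 / 8 * (tupleMeasure (Fin 4) V (crossSet r L)).toReal := by
  have hset : {p ∈ crossingTuples V r L | crossing L p ⊆ L} =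
      crossSet r L ∩ injTuples (Fin 4) V := by
    ext p
    refine ⟨fun h => ⟨h.1.2.2, h.1.1, h.1.2.1⟩, fun h => ⟨⟨h.2.1, h.2.2, h.1⟩, ?_⟩⟩
    rintro _ ⟨⟨v, -, rfl⟩, -⟩
    exact Submodule.starProjection_apply_mem L v
  rw [crossingCount, hset, tupleMeasure_apply hV (isClosed_crossSet r L).measurableSet,
    ← ((injTuples_finite hV).inter_of_right _).cast_ncard_eq]
  simp

/-! ### Explicit covariance bound -/

/-- A bound for the contribution of the pairs of crossings with one or two common points. -/
noncomputable def lowOverlapBound (R t ρ : ℝ) : ℝ :=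
  2048 * R * (2048 * R * (t ^ 7 * ρ ^ 16) + 256 * R * (t ^ 6 * ρ ^ 13) + 64 * (t ^ 6 * ρ ^ 14))

/-- A bound for the contribution of the pairs of crossings with three or four common points, if the
sine of the angle between the directions of projection is at least `δ`. -/
noncomputable def highOverlapBound (t ρ δ : ℝ) : ℝ :=
  12288 * (1 + 8 * (t * ρ ^ 3)) * (t ^ 4 * ρ ^ 9) / δ

lemma ofReal_overlap_bound {b τ D t : ℝ} (hb : 0 ≤ b) (hτ : 0 ≤ τ) (hD : 0 ≤ D) (ht : 0 ≤ t) :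
    ENNReal.ofReal ((b * (b * τ) + (b * τ + b * b)) * (b * (b * (τ * t))) +
        (1 + b) * (b * (b * (D * t)))) =
      (ENNReal.ofReal b * (ENNReal.ofReal b * ENNReal.ofReal τ) +
          (ENNReal.ofReal b * ENNReal.ofReal τ + ENNReal.ofReal b * ENNReal.ofReal b)) *
        (ENNReal.ofReal b * (ENNReal.ofReal b * (ENNReal.ofReal τ * ENNReal.ofReal t))) +
      (1 + ENNReal.ofReal b) *
        (ENNReal.ofReal b * (ENNReal.ofReal b * (ENNReal.ofReal D * ENNReal.ofReal t))) := by
  lift b to NNReal using hb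
  lift τ to NNReal using hτ
  lift D to NNReal using hD
  lift t to NNReal using ht
  simp only [ENNReal.ofReal_coe_nnreal]
  norm_cast
  rw [ENNReal.ofReal_coe_nnreal]

theorem covariance_crossingCount_le {Ω : Type*} [MeasurableSpace Ω] {P : Measure Ω}
    [IsProbabilityMeasure P] {z : E3} {R t ρ δ : ℝ} (hW : volume (Metric.closedBall z R) = 1)
    (hR : 0 ≤ R) (ht : 0 ≤ t) (hρ : 0 ≤ ρ) (hδ : 0 < δ) {η : Ω → Set E3}
    (h : IsPoissonProcess P (ENNReal.ofReal t • volume.restrict (Metric.closedBall z R)) η)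
    {x y : E3} (hx : ‖x‖ = 1) (hy : ‖y‖ = 1)
    (hxy : δ ≤ Real.sin (InnerProductGeometry.angle x y)) {L L' : Submodule ℝ E3}
    (hL : ∀ v, L.starProjection v = perp x v) (hL' : ∀ v, L'.starProjection v = perp y v) :
    MemLp (fun ω => crossingCount (η ω) ρ L L) 2 P ∧
    MemLp (fun ω => crossingCount (η ω) ρ L' L') 2 P ∧
    cov[fun ω => crossingCount (η ω) ρ L L, fun ω => crossingCount (η ω) ρ L' L'; P] ≤
      1 / 64 * ((gluePatterns (Fin 4)).card *
        (lowOverlapBound R t ρ + highOverlapBound t ρ δ)) := by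
  set Λ : Measure E3 := ENNReal.ofReal t • volume.restrict (Metric.closedBall z R) with hΛ
  have hΛu : Λ Set.univ = ENNReal.ofReal t := by simp [hΛ, hW]
  have : IsFiniteMeasure Λ := ⟨by rw [hΛu]; exact ENNReal.ofReal_lt_top⟩
  have : NullSingletonClass Λ := ⟨fun v => by simp [hΛ]⟩
  obtain ⟨η', hP, hfin, hae⟩ := h.exists_finite
  let N : Submodule ℝ E3 → Ω → ENNReal := fun L ω => tupleMeasure (Fin 4) (η' ω) (crossSet ρ L)
  have hNm : ∀ L, Measurable (N L) := fun L =>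
    (Measure.measurable_coe (isClosed_crossSet ρ L).measurableSet).comp
      (measurable_tupleMeasure hP hfin)
  have hNfin : ∀ L ω, N L ω ≠ ⊤ := by
    intro L ω
    simp only [N, tupleMeasure_apply (hfin ω) (isClosed_crossSet ρ L).measurableSet]
    simpa using (injTuples_finite (hfin ω)).inter_of_right _
  have hcount : ∀ L, (fun ω => crossingCount (η ω) ρ L L) =ᵐ[P]
      fun ω => 1 / 8 * (N L ω).toReal := by
    intro L
    filter_upwards [hae] with ω hω
    rw [← hω, crossingCount_eq_toReal_tupleMeasure (hfin ω)]
  have hb := intensity_ball_le (z := z) (R := R) ht hρ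
  have h2ρ : 0 ≤ 2 * ρ := by linarith
  have hτ : ∀ {u : E3}, ‖u‖ = 1 → ∀ c, Λ {w | ‖perp u (w - c)‖ ≤ 2 * ρ} ≤
      ENNReal.ofReal (t * (8 * R * (2 * ρ) ^ 2)) := fun hu c =>
    intensity_tube_le ht hR hu h2ρ c
  have hD := intensity_tube_inter_tube_le (z := z) (R := R) ht hx hy hδ hxy h2ρ
    (by linarith : 0 ≤ 4 * ρ)
  have hsq : ∀ {u : E3} {L : Submodule ℝ E3}, ‖u‖ = 1 → (∀ v, L.starProjection v = perp u v) →
      ∫⁻ ω, N L ω * N L ω ∂P ≠ ⊤ := by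
    intro u L hu hLu
    -- For equal directions there is no transversality; the tube bound serves as `D`, since only
    -- finiteness is needed.
    refine ne_top_of_le_ne_top ?_ (lintegral_tupleMeasure_crossSet_mul_le hP hfin hu hLu hu hLu
      ENNReal.ofReal_ne_top hb ENNReal.ofReal_ne_top (hτ hu) (hτ hu)
      ENNReal.ofReal_ne_top (fun c => (measure_mono fun w hw => hw.1).trans (hτ hu c)))
    rw [lintegral_tupleMeasure hP hfin (isClosed_crossSet ρ L).measurableSet, hΛu]
    finiteness
  have hmem : ∀ {u : E3} {L : Submodule ℝ E3}, ‖u‖ = 1 → (∀ v, L.starProjection v = perp u v) →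
      MemLp (fun ω => crossingCount (η ω) ρ L L) 2 P := fun {u L} hu hLu =>
    (memLp_congr_ae (hcount L)).2 ((memLp_two_toReal (hNm L) (hsq hu hLu)).const_mul _)
  refine ⟨hmem hx hL, hmem hy hL', ?_⟩
  rw [covariance_congr_ae (hcount L) (hcount L'), covariance_const_mul_left,
    covariance_const_mul_right, ← mul_assoc, show (1 / 8 : ℝ) * (1 / 8) = 1 / 64 by norm_num]
  refine mul_le_mul_of_nonneg_left ?_ (by norm_num)
  have hlow : 0 ≤ lowOverlapBound R t ρ := by unfold lowOverlapBound; positivity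
  have hhigh : 0 ≤ highOverlapBound t ρ δ := by unfold highOverlapBound; positivity
  refine covariance_toReal_le (hNm L) (hNm L') (hNfin L) (hNfin L') (hsq hx hL) (hsq hy hL')
    (by positivity) ?_
  refine (lintegral_tupleMeasure_crossSet_mul_le hP hfin hx hL hy hL' ENNReal.ofReal_ne_top hb
    ENNReal.ofReal_ne_top (hτ hx) (hτ hy) ENNReal.ofReal_ne_top hD).trans_eq ?_
  congr 1
  rw [hΛu, ENNReal.ofReal_mul (Nat.cast_nonneg (gluePatterns (Fin 4)).card), ENNReal.ofReal_natCast]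
  congr 1
  have hb0 : 0 ≤ t * (8 * ρ ^ 3) := by positivity
  have hτ0 : 0 ≤ t * (8 * R * (2 * ρ) ^ 2) := by positivity
  have hD0 : 0 ≤ t * (8 * ((2 * ρ + 4 * ρ) / δ) * (2 * ρ) ^ 2) := by positivity
  rw [← ofReal_overlap_bound hb0 hτ0 hD0 ht]
  congr 1
  -- The constants come from b = 8tρ³, τ = 32Rtρ² and D = 192tρ³/δ: b²τ = 2048Rt³ρ⁸, bτ = 256Rt²ρ⁵,
  -- b² = 64t²ρ⁶ and b²Dt = 12288t⁴ρ⁹/δ.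
  unfold lowOverlapBound highOverlapBound
  field_simp
  ring

/-! ### Sparse asymptotics, separated directions and conclusion -/

lemma eventually_le_one_of_sparse {r : ℝ → ℝ} (hr : ∀ t : ℝ, 0 < t → 0 < r t)
    (hsparse : Tendsto (fun t : ℝ => t * r t ^ 3) atTop (𝓝 0)) :
    ∀ᶠ t in atTop, 1 ≤ t ∧ 0 < r t ∧ r t ≤ 1 ∧ t * r t ^ 3 ≤ 1 := by
  filter_upwards [eventually_ge_atTop 1, hsparse.eventually_le_const zero_lt_one] with t h1 h2
  have hrt := hr t (by linarith)
  refine ⟨h1, hrt, ?_, h2⟩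
  by_contra! hcon
  have : 1 < r t ^ 3 := one_lt_pow₀ hcon (by norm_num)
  nlinarith

lemma isBigO_lowOverlapBound {R : ℝ} (hR : 0 ≤ R) {r : ℝ → ℝ} (hr : ∀ t : ℝ, 0 < t → 0 < r t)
    (hsparse : Tendsto (fun t : ℝ => t * r t ^ 3) atTop (𝓝 0)) :
    (fun t => lowOverlapBound R t (r t)) =O[atTop] fun t : ℝ => t ^ 6 * r t ^ 13 := by
  refine IsBigO.of_bound (2048 * R * (2048 * R + 256 * R + 64)) ?_
  filter_upwards [eventually_le_one_of_sparse hr hsparse] with t ⟨h1, hr0, hr1, hs⟩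
  have hpos : 0 ≤ t ^ 6 * r t ^ 13 := by positivity
  rw [Real.norm_of_nonneg (by unfold lowOverlapBound; positivity), Real.norm_of_nonneg hpos]
  have e1 : t ^ 7 * r t ^ 16 ≤ t ^ 6 * r t ^ 13 := by
    have := mul_le_mul_of_nonneg_left hs hpos
    linarith
  have e2 : t ^ 6 * r t ^ 14 ≤ t ^ 6 * r t ^ 13 := by
    have := mul_le_mul_of_nonneg_left hr1 hpos
    linarith
  calc lowOverlapBound R t (r t) ≤ 2048 * R * (2048 * R * (t ^ 6 * r t ^ 13) +
        256 * R * (t ^ 6 * r t ^ 13) + 64 * (t ^ 6 * r t ^ 13)) := by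
        unfold lowOverlapBound
        gcongr
    _ = _ := by ring

lemma isBigO_highOverlapBound {r : ℝ → ℝ} (hr : ∀ t : ℝ, 0 < t → 0 < r t)
    (hsparse : Tendsto (fun t : ℝ => t * r t ^ 3) atTop (𝓝 0)) {α : ℝ} (hα : 0 < α) :
    (fun t => highOverlapBound t (r t) (t ^ (-α) / 2)) =O[atTop]
      fun t : ℝ => t ^ (4 + 3 * α) * r t ^ 9 := by
  refine IsBigO.of_bound (24576 * (1 + 8 * 1)) ?_
  filter_upwards [eventually_le_one_of_sparse hr hsparse] with t ⟨h1, hr0, hr1, hs⟩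
  have ht : 0 < t := by linarith
  -- The argument yields t^(4+α) r⁹, which for t ≥ 1 is stronger than the order required.
  have hpow : t ^ (4 : ℕ) * t ^ α ≤ t ^ (4 + 3 * α) := by
    rw [← Real.rpow_natCast t 4, ← Real.rpow_add ht]
    refine Real.rpow_le_rpow_of_exponent_le h1 ?_
    push_cast
    linarith
  have heq : highOverlapBound t (r t) (t ^ (-α) / 2) =
      24576 * (1 + 8 * (t * r t ^ 3)) * (t ^ (4 : ℕ) * t ^ α * r t ^ 9) := by
    have : t ^ α ≠ 0 := (Real.rpow_pos_of_pos ht α).ne'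
    rw [highOverlapBound, Real.rpow_neg ht.le]
    field_simp
    ring
  rw [heq, Real.norm_of_nonneg (by positivity), Real.norm_of_nonneg (by positivity)]
  gcongr

/-- In the positive octant inner products are nonnegative, so angles are at most π/2; there sin φ ≥
2φ/π ≥ φ/2. -/
lemma half_le_sin_angle_of_lt_dSphere {x y : Sphere2} (hx : x ∈ spherePos) (hy : y ∈ spherePos) {a : ℝ}
    (h : dSphere x y > a) : a / 2 ≤ Real.sin (InnerProductGeometry.angle (x : E3) (y : E3)) := by
  have hinner : 0 ≤ inner ℝ (x : E3) (y : E3) := by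
    rw [PiLp.inner_apply]
    exact Finset.sum_nonneg fun i _ => by
      simpa using mul_nonneg (hy i).le (hx i).le
  have h0 := InnerProductGeometry.angle_nonneg (x : E3) (y : E3)
  have hle : InnerProductGeometry.angle (x : E3) (y : E3) ≤ Real.pi / 2 :=
    Real.arccos_le_pi_div_two.2 (by positivity)
  have hsin := Real.mul_le_sin h0 hle
  have hpi : (1 / 2 : ℝ) ≤ 2 / Real.pi := by
    rw [div_le_div_iff₀ (by norm_num) Real.pi_pos]
    linarith [Real.pi_le_four]
  have := mul_le_mul_of_nonneg_right hpi h0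
  unfold dSphere at h
  linarith

theorem mainTheorem4
    (z : E3) (R : ℝ) (hW : volume (Metric.closedBall z R) = 1)
    (r : ℝ → ℝ) (hr : ∀ t : ℝ, 0 < t → 0 < r t)
    (hsparse : Tendsto (fun t : ℝ => t * r t ^ 3) atTop (𝓝 0))
    (α : ℝ) (hα : 0 < α) :
    ∃ c₁ c₂ : ℝ → ℝ,
      c₁ =O[atTop] (fun t : ℝ => t ^ 6 * r t ^ 13) ∧
      c₂ =O[atTop] (fun t : ℝ => t ^ (4 + 3 * α) * r t ^ 9) ∧
      ∀ (Ω : Type*) [MeasurableSpace Ω] (P : Measure Ω) [IsProbabilityMeasure P]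
        (t : ℝ) (_ : 0 < t) (η : Ω → Set E3)
        (_ : IsPoissonProcess P (ENNReal.ofReal t • volume.restrict (Metric.closedBall z R)) η)
        (θ : Sphere2 → Matrix.specialOrthogonalGroup (Fin 3) ℝ)
        (_ : ∀ x : Sphere2, rotate (θ x) (EuclideanSpace.single 2 1) = (x : E3)),
        ∀ x ∈ spherePos, ∀ y ∈ spherePos, dSphere x y > t ^ (-α) →
          MemLp (fun ω => crossingCount (η ω) (r t) (plane θ x) (plane θ x)) 2 P ∧
          MemLp (fun ω => crossingCount (η ω) (r t) (plane θ y) (plane θ y)) 2 P ∧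
          cov[fun ω => crossingCount (η ω) (r t) (plane θ x) (plane θ x),
            fun ω => crossingCount (η ω) (r t) (plane θ y) (plane θ y); P] < c₁ t + c₂ t := by
  have hR : 0 ≤ R := by
    by_contra! hneg
    rw [Metric.closedBall_eq_empty.2 hneg, measure_empty] at hW
    exact zero_ne_one hW
  set M : ℝ := ((gluePatterns (Fin 4)).card : ℝ)
  -- The factor M + 1 exceeds M/64 and is positive; with the positivity of the second bound this
  -- makes the final inequality strict.
  refine ⟨fun t => (M + 1) * lowOverlapBound R t (r t),
    fun t => (M + 1) * highOverlapBound t (r t) (t ^ (-α) / 2),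
    (isBigO_lowOverlapBound hR hr hsparse).const_mul_left _,
    (isBigO_highOverlapBound hr hsparse hα).const_mul_left _, ?_⟩
  intro Ω _ P _ t ht η h θ hθ x hx y hy hxy
  have hδ : 0 < t ^ (-α) / 2 := by positivity
  have hrt := hr t ht
  obtain ⟨h1, h2, h3⟩ := covariance_crossingCount_le hW hR ht.le hrt.le hδ h
    (norm_eq_of_mem_sphere x) (norm_eq_of_mem_sphere y) (half_le_sin_angle_of_lt_dSphere hx hy hxy)
    (starProjection_plane (hθ x)) (starProjection_plane (hθ y))
  refine ⟨h1, h2, h3.trans_lt ?_⟩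
  have hlow : 0 ≤ lowOverlapBound R t (r t) := by unfold lowOverlapBound; positivity
  have hhigh : 0 < highOverlapBound t (r t) (t ^ (-α) / 2) := by
    unfold highOverlapBound; positivity
  have hM : 0 ≤ M := Nat.cast_nonneg _
  change 1 / 64 * (M * _) < _
  nlinarith [mul_nonneg hM (add_nonneg hlow hhigh.le)]
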